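/- Let $n\ge 1$ and $k\ge 0$ be integers. **Partitions and weights.** Let $\mathcal P_{\le n-1,k}$ be the set of partitions $\lambda=(\lambda_1\ge\dots\ge\lambda_{n-1}\ge 0)$ with $\lambda_1\le k$; put $\lambda_n=0$, $|\lambda|=\sum_i\lambda_i$, and let $\lambda^t$ be the transposed partition. Let $P_k^+$ be the set of $n$-tuples $m=(m_1,\dots,m_n)$ of non-negative integers with $\sum_i m_i=k$ (the dominant integral weights of $\widehat{\mathfrak{su}}(n)$ of level $k$), and for $\lambda\in\mathcal P_{\le n-1,k}$ let $\hat\lambda\in P_k^+$ be given by $m_i=\lambda_i-\lambda_{i+1}$ for $1\le i\le n-1$ and $m_n=k-\lambda_1$ (for $n=1$: $m_1=k$). **Affine plactic Schur polynomials (at $z=1$).** On the complex vector space with basis $\mathbb Z_{\ge0}^n$ let $\varphi_i^*m=(m_1,\dots,m_i+1,\dots,m_n)$, and $\varphi_i m=(m_1,\dots,m_i-1,\dots,m_n)$ if $m_i>0$, $\varphi_i m=0$ otherwise. Put $a_j=\varphi_{j+1}^*\varphi_j$ for $1\le j\le n-1$, $$h_r(a)=\sum_{\varepsilon_0+\dots+\varepsilon_{n-1}=r}(\varphi_1^*)^{\varepsilon_0}a_1^{\varepsilon_1}\cdots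 a_{n-1}^{\varepsilon_{n-1}}\varphi_n^{\varepsilon_0}\quad(r\ge0),\qquad h_r(a)=0\quad(r<0),$$ and $s_\lambda(a)=\det\big(h_{\lambda_i-i+j}(a)\big)_{1\le i,j\le n-1}$, where in each term of the Leibniz expansion the factors are multiplied in the order of the rows. These operators preserve the span $\mathbb CP_k^+$ of $P_k^+$; let $s_\lambda(a)_k$ be the restriction of $s_\lambda(a)$ to $\mathbb CP_k^+$, and let $\mathcal F'_{n,k}\subset\mathrm{End}(\mathbb CP_k^+)$ be the (unital) $\mathbb C$-subalgebra generated by all $s_\lambda(a)_k$, $\lambda\in\mathcal P_{\le n-1,k}$. **Bethe variety.** In $\mathbb C[e_1,\dots,e_k]$ put $e_0=1$, $e_r=0$ for $r<0$ or $r>k$, and $h_r=\det(e_{1-i+j})_{1\le i,j\le r}$. Let $\mathbb V_{n,k}\subset\mathbb C^k$ be the common zero set of the $k$ polynomials $h_n-1,h_{n+1},\dots,h_{n+k-1}$, and $\mathcal I(\mathbb V_{n,k})\subset\mathbb C[e_1,\dots,e_k]$ the ideal of all polynomials vanishing on $\mathbb V_{n,k}$. Identify $\mathbb C[e_1,\dots,e_k]$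 with $\mathbb C[x_1,\dots,x_k]^{S_k}$, $e_r$ being the $r$-th elementary symmetric polynomial; for $\lambda\in\mathcal P_{\le n-1,k}$ let $[s_{\lambda^t}]$ be the class modulo $\mathcal I(\mathbb V_{n,k})$ of the Schur polynomial $s_{\lambda^t}(x_1,\dots,x_k)=\sum_T x^T$, the sum over semistandard tableaux $T$ of shape $\lambda^t$ with entries in $\{1,\dots,k\}$. **Fusion coefficients.** Let $(\sigma+\rho)_i=\sigma_i-\frac{|\sigma|}n+\frac{n+1}2-i$ for $1\le i\le n$, and $$S_{\hat\lambda\hat\sigma}=\frac{e^{i\pi n(n-1)/4}}{\sqrt{n(k+n)^{n-1}}}\sum_{w\in S_n}\operatorname{sgn}(w)\,e^{-\frac{2\pi i}{k+n}(\sigma+\rho,\,w(\lambda+\rho))},\qquad \mathcal N^{(k),\hat\nu}_{\hat\lambda\hat\mu}=\sum_{\sigma\in\mathcal P_{\le n-1,k}}\frac{S_{\hat\lambda\hat\sigma}S_{\hat\mu\hat\sigma}(S^{-1})_{\hat\nu\hat\sigma}}{S_{\hat\emptyset\hat\sigma}},$$ with $(\cdot,\cdot)$ the standard inner product of $\mathbb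 R^n$ and $S_n$ permuting coordinates. **Claim.** (1) There is an isomorphism of $\mathbb C$-algebras $\mathcal F'_{n,k}\cong\mathbb C[e_1,\dots,e_k]/\mathcal I(\mathbb V_{n,k})$ with $s_\lambda(a)_k\mapsto[s_{\lambda^t}]$ for all $\lambda\in\mathcal P_{\le n-1,k}$. (2) For all $\lambda,\mu\in\mathcal P_{\le n-1,k}$, $$s_\lambda(a)_k\,s_\mu(a)_k=\sum_{\nu\in\mathcal P_{\le n-1,k}}\mathcal N^{(k),\hat\nu}_{\hat\lambda\hat\mu}\,s_\nu(a)_k .$$ (3) The operators $s_\lambda(a)_k$ are the fusion matrices: for all $\lambda,\mu\in\mathcal P_{\le n-1,k}$, $$s_\lambda(a)_k\,\hat\mu=\sum_{\nu\in\mathcal P_{\le n-1,k}}\mathcal N^{(k),\hat\nu}_{\hat\lambda\hat\mu}\,\hat\nu .$$ -/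

import Mathlib

/-!
Throughout, `N` is the rank and `n = N + 1`, so that the algebra in question is the affine
`su(N + 1)`. Sites `1, ..., n` of the affine Dynkin diagram are `0, ..., N` in `Fin (N + 1)`;
the site `n` (the affine node) is `Fin.last N`. The quasi-periodicity parameter is `z = 1`.
-/

noncomputable section

namespace PhaseModel

/-! ### The state space and the phase algebra -/

/-- The space `ℂP⁺` spanned by all `n`-tuples of Dynkin labels `(m₁, ..., mₙ)`. -/
abbrev State (N : ℕ) : Type := (Fin (N + 1) → ℕ) →₀ ℂ

/-- The subspace `ℂP⁺ₖ` spanned by the tuples with `m₁ + ... + mₙ = k`. -/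
def level (N k : ℕ) : Submodule ℂ (State N) :=
  Finsupp.supported ℂ ℂ {m | ∑ i, m i = k}

/-- `φᵢ* (m₁, ..., mₙ) = (m₁, ..., mᵢ + 1, ..., mₙ)`. -/
def phiStar {N : ℕ} (i : Fin (N + 1)) : Module.End ℂ (State N) :=
  Finsupp.linearCombination ℂ fun m => Finsupp.single (Function.update m i (m i + 1)) 1

/-- `φᵢ (m₁, ..., mₙ) = (m₁, ..., mᵢ - 1, ..., mₙ)` if `mᵢ > 0`, and `0` otherwise. -/
def phi {N : ℕ} (i : Fin (N + 1)) : Module.End ℂ (State N) :=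
  Finsupp.linearCombination ℂ fun m =>
    if 0 < m i then Finsupp.single (Function.update m i (m i - 1)) 1 else 0

/-- The finite plactic generators `aⱼ = φⱼ₊₁* φⱼ`, `1 ≤ j ≤ n - 1`. -/
def plactic {N : ℕ} (j : Fin N) : Module.End ℂ (State N) :=
  phiStar j.succ * phi j.castSucc

/-! ### Affine plactic polynomials -/

/-- The affine plactic complete symmetric polynomial (at `z = 1`): the sum over all compositions
`ε = (ε₀, ..., εₙ₋₁)` of `r` of `(φ₁*)^ε₀ a₁^ε₁ ⋯ aₙ₋₁^εₙ₋₁ φₙ^ε₀`. -/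
def placticH (N r : ℕ) : Module.End ℂ (State N) :=
  ∑ ε ∈ Finset.piAntidiag (Finset.univ : Finset (Fin (N + 1))) r,
    phiStar 0 ^ ε 0 * (List.ofFn fun j : Fin N => plactic j ^ ε j.succ).prod *
      phi (Fin.last N) ^ ε 0

/-- `hᵣ` for an integer index, with `hᵣ = 0` for `r < 0`. -/
def placticHInt (N : ℕ) (r : ℤ) : Module.End ℂ (State N) :=
  if 0 ≤ r then placticH N r.toNat else 0

/-- Partitions whose Young diagram fits into the box of height `N = n - 1` and width `k`. -/
abbrev BoxPartition (N k : ℕ) : Type := {lam : Fin N → Fin (k + 1) // Antitone lam}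

/-- The affine plactic Schur polynomial `det (h_{λᵢ - i + j})`, `1 ≤ i, j ≤ n - 1`. The entries
are operators; in the Leibniz expansion the factors are taken in the order of the rows. -/
def placticSchur {N k : ℕ} (lam : BoxPartition N k) : Module.End ℂ (State N) :=
  ∑ w : Equiv.Perm (Fin N), ((Equiv.Perm.sign w : ℤ) : ℂ) •
    (List.ofFn fun i : Fin N =>
      placticHInt N (((lam.1 i : ℕ) : ℤ) - ((i : ℕ) : ℤ) + ((w i : ℕ) : ℤ))).prod

/-! ### Restriction to a fixed level -/

/-- The level spaces indexed by integers (zero for negative index); used only to see that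
the affine plactic polynomials preserve every level. -/
def levelInt (N : ℕ) (d : ℤ) : Submodule ℂ (State N) :=
  Finsupp.supported ℂ ℂ {m | ((∑ i, m i : ℕ) : ℤ) = d}

theorem level_eq_levelInt (N k : ℕ) : level N k = levelInt N k := by
  simp only [level, levelInt, Nat.cast_inj]

theorem sum_update_int {N : ℕ} (m : Fin (N + 1) → ℕ) (i : Fin (N + 1)) (a : ℕ) :
    ((∑ j, Function.update m i a j : ℕ) : ℤ) = ((∑ j, m j : ℕ) : ℤ) - (m i : ℤ) + (a : ℤ) := by
  have h1 := Finset.sum_update_of_mem (Finset.mem_univ i) m a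
  have h2 := Finset.add_sum_erase Finset.univ m (Finset.mem_univ i)
  rw [Finset.sdiff_singleton_eq_erase] at h1
  omega

/-- `f` maps level `e` to level `e + d`, for every `e`. -/
def Shifts {N : ℕ} (d : ℤ) (f : Module.End ℂ (State N)) : Prop :=
  ∀ e : ℤ, ∀ x ∈ levelInt N e, f x ∈ levelInt N (e + d)

theorem shifts_linearCombination {N : ℕ} (d : ℤ) (g : (Fin (N + 1) → ℕ) → State N)
    (hg : ∀ m, g m ∈ levelInt N (((∑ i, m i : ℕ) : ℤ) + d)) :
    Shifts d (Finsupp.linearCombination ℂ g) := by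
  intro e x hx
  rw [Finsupp.linearCombination_apply]
  refine Submodule.sum_mem _ fun m hm => Submodule.smul_mem _ _ ?_
  have h : ((∑ i, m i : ℕ) : ℤ) = e := hx hm
  exact h ▸ hg m

theorem shifts_phiStar {N : ℕ} (i : Fin (N + 1)) : Shifts 1 (phiStar i) := by
  refine shifts_linearCombination _ _ fun m => Finsupp.single_mem_supported ℂ _ ?_
  rw [Set.mem_ofPred_eq, sum_update_int]
  push_cast
  ring

theorem shifts_phi {N : ℕ} (i : Fin (N + 1)) : Shifts (-1) (phi i) := by
  refine shifts_linearCombination _ _ fun m => ?_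
  split_ifs with h
  · refine Finsupp.single_mem_supported ℂ _ ?_
    rw [Set.mem_ofPred_eq, sum_update_int]
    omega
  · exact Submodule.zero_mem _

theorem Shifts.mul {N : ℕ} {d d' : ℤ} {f g : Module.End ℂ (State N)} (hf : Shifts d f)
    (hg : Shifts d' g) : Shifts (d' + d) (f * g) := by
  intro e x hx
  rw [← add_assoc]
  exact hf _ _ (hg e x hx)

theorem shifts_one (N : ℕ) : Shifts 0 (1 : Module.End ℂ (State N)) := by
  intro e x hx
  simpa using hx

theorem Shifts.pow {N : ℕ} {d : ℤ} {f : Module.End ℂ (State N)} (hf : Shifts d f) (r : ℕ) :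
    Shifts (r * d) (f ^ r) := by
  induction r with
  | zero => simpa using shifts_one N
  | succ r ih =>
    have h := ih.mul hf
    rw [← pow_succ] at h
    convert h using 1
    push_cast
    ring

theorem shifts_list_prod {N : ℕ} (l : List (Module.End ℂ (State N)))
    (hl : ∀ f ∈ l, Shifts 0 f) : Shifts 0 l.prod := by
  induction l with
  | nil => simpa using shifts_one N
  | cons f l ih =>
    rw [List.prod_cons]
    simpa using (hl f (by simp)).mul (ih fun g hg => hl g (by simp [hg]))

theorem shifts_placticH (N r : ℕ) : Shifts 0 (placticH N r) := by
  intro e x hx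
  rw [placticH, LinearMap.sum_apply]
  refine Submodule.sum_mem _ fun ε _ => ?_
  have ha : Shifts 0 (List.ofFn fun j : Fin N => plactic j ^ ε j.succ).prod := by
    refine shifts_list_prod _ fun f hf => ?_
    obtain ⟨j, rfl⟩ := (List.mem_ofFn' _ _).1 hf
    have h := ((shifts_phiStar j.succ).mul (shifts_phi j.castSucc)).pow (ε j.succ)
    simpa [plactic] using h
  have h := (((shifts_phiStar (N := N) 0).pow (ε 0)).mul ha).mul
    ((shifts_phi (Fin.last N)).pow (ε 0)) e x hx
  simpa using h

theorem shifts_placticHInt (N : ℕ) (r : ℤ) : Shifts 0 (placticHInt N r) := by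
  unfold placticHInt
  split_ifs
  · exact shifts_placticH _ _
  · intro e x _
    exact Submodule.zero_mem _

theorem placticSchur_mem_level {N k : ℕ} (lam : BoxPartition N k) :
    ∀ x ∈ level N k, placticSchur lam x ∈ level N k := by
  intro x hx
  rw [level_eq_levelInt] at hx ⊢
  rw [placticSchur, LinearMap.sum_apply]
  refine Submodule.sum_mem _ fun w _ => Submodule.smul_mem _ _ ?_
  have h := shifts_list_prod (N := N) (List.ofFn fun i : Fin N =>
      placticHInt N (((lam.1 i : ℕ) : ℤ) - ((i : ℕ) : ℤ) + ((w i : ℕ) : ℤ))) (by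
    intro f hf
    obtain ⟨i, rfl⟩ := (List.mem_ofFn' _ _).1 hf
    exact shifts_placticHInt _ _) _ x hx
  simpa using h

/-- The affine plactic Schur polynomial restricted to `ℂP⁺ₖ`. -/
def placticSchurLevel {N k : ℕ} (lam : BoxPartition N k) : Module.End ℂ (level N k) :=
  (placticSchur lam).restrict (placticSchur_mem_level lam)

/-- The subalgebra of `End ℂP⁺ₖ` generated by the restricted affine plactic Schur polynomials. -/
def placticSchurAlgebra (N k : ℕ) : Subalgebra ℂ (Module.End ℂ (level N k)) :=
  Algebra.adjoin ℂ (Set.range (placticSchurLevel (N := N) (k := k)))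

/-- The restricted affine plactic Schur polynomial as an element of that subalgebra. -/
def placticSchurGen {N k : ℕ} (lam : BoxPartition N k) : placticSchurAlgebra N k :=
  ⟨placticSchurLevel lam, Algebra.subset_adjoin ⟨lam, rfl⟩⟩

/-! ### Weights, the modular S-matrix and the fusion coefficients -/

/-- The part `λ_{i+1}` of a partition (`i` counts from `0`), with `λₙ = 0`. -/
def part {N k : ℕ} (lam : BoxPartition N k) (i : ℕ) : ℕ :=
  if h : i < N then (lam.1 ⟨i, h⟩ : ℕ) else 0

/-- The Dynkin labels of the affine weight of level `k` of a partition: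
`mᵢ = λᵢ - λᵢ₊₁` for `1 ≤ i ≤ n - 1`, and `mₙ = k - λ₁`. -/
def dynkin {N k : ℕ} (lam : BoxPartition N k) (i : Fin (N + 1)) : ℕ :=
  if i = Fin.last N then k - part lam 0 else part lam i - part lam (i + 1)

theorem sum_dynkin {N k : ℕ} (lam : BoxPartition N k) : ∑ i, dynkin lam i = k := by
  have hp : Antitone (part lam) := by
    intro i j hij
    unfold part
    split_ifs with h1 h2
    · exact lam.2 (show (⟨i, h2⟩ : Fin N) ≤ ⟨j, h1⟩ from hij)
    · omega
    · exact Nat.zero_le _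
    · exact le_rfl
  have h0 : part lam 0 ≤ k := by
    unfold part
    split_ifs
    · exact Nat.lt_succ_iff.1 (lam.1 _).2
    · exact Nat.zero_le _
  have hN : part lam N = 0 := by simp [part]
  have hsum : ∀ M : ℕ,
      ∑ i ∈ Finset.range M, (part lam i - part lam (i + 1)) = part lam 0 - part lam M := by
    intro M
    induction M with
    | zero => simp
    | succ M ih =>
      rw [Finset.sum_range_succ, ih]
      have h3 := hp (Nat.zero_le M)
      have h4 := hp (Nat.le_succ M)
      simp only [Nat.succ_eq_add_one] at h4
      omega
  rw [Fin.sum_univ_castSucc]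
  have h1 : ∀ i : Fin N, dynkin lam i.castSucc = part lam i - part lam (i + 1) := fun i => by
    simp [dynkin, (Fin.castSucc_lt_last i).ne]
  have h2 : dynkin lam (Fin.last N) = k - part lam 0 := by simp [dynkin]
  rw [Finset.sum_congr rfl fun i _ => h1 i, h2,
    Fin.sum_univ_eq_sum_range (fun i => part lam i - part lam (i + 1)) N,
    hsum N, hN]
  omega

/-- The basis vector of `ℂP⁺ₖ` given by the affine weight of a partition. -/
def weightVec {N k : ℕ} (lam : BoxPartition N k) : level N k :=
  ⟨Finsupp.single (dynkin lam) 1, Finsupp.single_mem_supported ℂ _ (sum_dynkin lam)⟩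

/-- The coordinates in `ℝⁿ` of the finite weight `λ` plus the Weyl vector `ρ`: the `i`-th
coordinate is `(λᵢ - |λ| / n) + ((n + 1) / 2 - i)` for `1 ≤ i ≤ n`. -/
def shiftedWeight {N k : ℕ} (lam : BoxPartition N k) (i : Fin (N + 1)) : ℝ :=
  ((part lam i : ℝ) - (∑ j : Fin N, ((lam.1 j : ℕ) : ℝ)) / ((N : ℝ) + 1)) +
    ((N : ℝ) / 2 - ((i : ℕ) : ℝ))

/-- The modular `S`-matrix of affine `su(n)` at level `k`, given by the Kac-Peterson formula
(the Weyl group is the symmetric group, permuting coordinates). -/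
def modularS (N k : ℕ) : Matrix (BoxPartition N k) (BoxPartition N k) ℂ :=
  Matrix.of fun lam sig =>
    Complex.exp (Complex.I * Real.pi * ((N : ℂ) + 1) * (N : ℂ) / 4) /
        (Real.sqrt (((N : ℝ) + 1) * ((k : ℝ) + (N : ℝ) + 1) ^ N) : ℂ) *
      ∑ w : Equiv.Perm (Fin (N + 1)), ((Equiv.Perm.sign w : ℤ) : ℂ) *
        Complex.exp (-(2 * Real.pi * Complex.I / ((k : ℂ) + (N : ℂ) + 1)) *
          ((∑ i, shiftedWeight sig i * shiftedWeight lam (w⁻¹ i) : ℝ) : ℂ))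

/-- The empty partition. -/
def emptyPartition (N k : ℕ) : BoxPartition N k := ⟨fun _ => 0, fun _ _ _ => le_rfl⟩

/-- The fusion coefficients, given by the Verlinde formula. -/
def fusionCoeff {N k : ℕ} (lam mu nu : BoxPartition N k) : ℂ :=
  ∑ sig : BoxPartition N k,
    modularS N k lam sig * modularS N k mu sig * (modularS N k)⁻¹ nu sig /
      modularS N k (emptyPartition N k) sig

/-! ### Schur polynomials -/

/-- The Young diagram of a partition (rows and columns counted from `0`). -/
def diagram {N k : ℕ} (lam : BoxPartition N k) : YoungDiagram where
  cells := (Finset.range N ×ˢ Finset.range k).filter fun c => c.2 < part lam c.1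
  isLowerSet := by
    rintro ⟨i, j⟩ ⟨i', j'⟩ ⟨hi, hj⟩ h
    simp only [Finset.coe_filter, Finset.mem_product, Finset.mem_range, Set.mem_ofPred_eq]
      at hi hj h ⊢
    obtain ⟨⟨h1, h2⟩, h3⟩ := h
    have hi' : i' < N := by omega
    refine ⟨⟨hi', by omega⟩, ?_⟩
    have hle : part lam i ≤ part lam i' := by
      simp only [part, h1, hi', dif_pos]
      exact lam.2 (show (⟨i', hi'⟩ : Fin N) ≤ ⟨i, h1⟩ from hi)
    omega

/-- A filling of a Young diagram with letters `1, ..., l` is semistandard if it is weakly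
increasing along rows and strictly increasing down columns. -/
def IsSemistandard {l : ℕ} (mu : YoungDiagram) (T : mu.cells → Fin l) : Prop :=
  (∀ c d : mu.cells, c.1.1 = d.1.1 → c.1.2 < d.1.2 → T c ≤ T d) ∧
    ∀ c d : mu.cells, c.1.2 = d.1.2 → c.1.1 < d.1.1 → T c < T d

open scoped Classical in
/-- The Schur polynomial `s_μ(x₁, ..., x_l)` as the weighted sum of semistandard tableaux. -/
def schurPoly (l : ℕ) (mu : YoungDiagram) : MvPolynomial (Fin l) ℂ :=
  ∑ T : mu.cells → Fin l with IsSemistandard mu T, ∏ c, MvPolynomial.X (T c)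

/-! ### The Bethe variety -/

/-- The element `e_r` of `ℂ[e₁, ..., e_k]`, with `e₀ = 1` and `e_r = 0` for `r < 0` and `r > k`;
the polynomial variable with index `r - 1` stands for `e_r`. -/
def eVar (k : ℕ) (r : ℤ) : MvPolynomial (Fin k) ℂ :=
  if r = 0 then 1
  else if h : 1 ≤ r ∧ r ≤ k then MvPolynomial.X ⟨(r - 1).toNat, by omega⟩
  else 0

/-- `h_r = det (e_{1 - i + j})`, `1 ≤ i, j ≤ r`, in `ℂ[e₁, ..., e_k]`. -/
def hPoly (k r : ℕ) : MvPolynomial (Fin k) ℂ :=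
  (Matrix.of fun i j : Fin r => eVar k (1 - ((i : ℕ) : ℤ) + ((j : ℕ) : ℤ))).det

/-- The variety `V(h_n - 1, h_{n+1}, ..., h_{n+k-1})` in `ℂ^k`, with coordinates
`e₁, ..., e_k`. -/
def betheVariety (n k : ℕ) : Set (Fin k → ℂ) :=
  MvPolynomial.zeroLocus ℂ (Ideal.span
    (Set.range fun i : Fin k => hPoly k (n + i) - if (i : ℕ) = 0 then 1 else 0))

/-- The vanishing ideal of the Bethe variety in `ℂ[e₁, ..., e_k]`. -/
def betheIdeal (n k : ℕ) : Ideal (MvPolynomial (Fin k) ℂ) :=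
  MvPolynomial.vanishingIdeal ℂ (betheVariety n k)

end PhaseModel

end

open PhaseModel

/-!
The plactic `h_r(a)` are diagonalised by the Bethe roots, the `n`-subsets `ξ` of the solutions of
`x ^ (n + k) = c` with product `1`. A weight `m` has distinct exponents `expo m j`, and a Pieri
computation with alternants shows that the functional `m ↦ det (ξ i ^ expo m j)` is a joint left
eigenvector with eigenvalues `h_r(ξ)`: the term that wraps around the affine Dynkin diagram is
produced by `ξ i ^ (n + k) = c`. So `s_λ(a)` has eigenvalue `s_λ(ξ)` on it.

Distinct Bethe roots have distinct values `(h₁(ξ), …, h_k(ξ))`, so by Dedekind's argument their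
functionals are independent. The partitions in the box index both Bethe roots and a basis of the
weights of level `k`, so these functionals form a basis of the dual space and there are no further
Bethe roots. Since the functional of `ξ` takes the value `s_λ(ξ)` on the weight `λ`, up to a factor
depending only on `ξ`, the `s_λ(a)` span all operators that are diagonal in this basis. The columns
of the `S`-matrix are, up to normalisation, the alternants at these Bethe roots, so that the
Verlinde formula expresses the simultaneous diagonalisation of the `s_λ(a)`.

On the side of the variety, `h_n = 1` and `h_{n+1} = ⋯ = h_{n+k-1} = 0` say that
`1 + e₁ X + ⋯ + e_k X ^ k` times a polynomial of degree `n` is, up to signs, `1 - c X ^ (n + k)`, so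
its points are the `(h₁(ξ), …, h_k(ξ))`: the coordinate ring is the algebra of functions on the
Bethe roots as well. The dual Jacobi-Trudi formula, which identifies the Schur polynomials, comes
from removing the horizontal strip of the largest entry of a tableau.
-/

noncomputable section

namespace PhaseModel

open scoped Polynomial PowerSeries

/-! ### Jacobi-Trudi determinants of a power series -/

section JacobiTrudi

variable {A : Type*} [CommRing A]

/-- The coefficient of a power series at an integer exponent, zero at negative exponents: the
convention under which `e_{μ_i - i + j}` and `h_{μ_i - i + j}` make sense for all indices. -/
def intCoeff (F : A⟦X⟧) (r : ℤ) : A :=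
  if 0 ≤ r then PowerSeries.coeff r.toNat F else 0

theorem intCoeff_natCast (F : A⟦X⟧) (r : ℕ) : intCoeff F r = PowerSeries.coeff r F := by
  simp [intCoeff]

theorem intCoeff_of_neg (F : A⟦X⟧) {r : ℤ} (hr : r < 0) : intCoeff F r = 0 :=
  if_neg hr.not_ge

theorem map_intCoeff {B : Type*} [CommRing B] (f : A →+* B) (F : A⟦X⟧) (r : ℤ) :
    f (intCoeff F r) = intCoeff (F.map f) r := by
  rw [intCoeff, intCoeff, apply_ite f, map_zero, PowerSeries.coeff_map]

theorem intCoeff_one (r : ℤ) : intCoeff (1 : A⟦X⟧) r = if r = 0 then 1 else 0 := by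
  rcases lt_or_ge r 0 with hr | hr
  · rw [intCoeff_of_neg _ hr, if_neg hr.ne]
  · lift r to ℕ using hr
    simp [intCoeff_natCast, PowerSeries.coeff_one]

theorem intCoeff_mul {F G : A⟦X⟧} {r : ℤ} {n : ℕ}
    (hG : ∀ b : ℕ, n ≤ b → (b : ℤ) ≤ r → PowerSeries.coeff b G = 0) :
    intCoeff (F * G) r = ∑ b ∈ Finset.range n, intCoeff F (r - b) * PowerSeries.coeff b G := by
  rcases lt_or_ge r 0 with hr | hr
  · rw [intCoeff_of_neg _ hr, Finset.sum_eq_zero fun b _ => ?_]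
    rw [intCoeff_of_neg _ (by omega), zero_mul]
  lift r to ℕ using hr
  rw [intCoeff_natCast, mul_comm, PowerSeries.coeff_mul,
    Finset.Nat.sum_antidiagonal_eq_sum_range_succ fun a b =>
      PowerSeries.coeff a G * PowerSeries.coeff b F]
  refine Finset.sum_congr_of_eq_on_inter (fun b hb hb' => ?_) (fun b _ hb' => ?_) fun b hb _ => ?_
  · rw [hG b (by simpa using hb') (by exact_mod_cast Finset.mem_range_succ_iff.1 hb), zero_mul]
  · rw [intCoeff_of_neg _ (by simp at hb'; omega), zero_mul]
  · rw [← Nat.cast_sub (Finset.mem_range_succ_iff.1 hb), intCoeff_natCast, mul_comm]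

theorem intCoeff_one_add_C_mul_X_mul (a : A) (F : A⟦X⟧) (r : ℤ) :
    intCoeff ((1 + PowerSeries.C a * PowerSeries.X) * F) r =
      a * intCoeff F (r - 1) + intCoeff F r := by
  rcases lt_or_ge r 0 with hr | hr
  · rw [intCoeff_of_neg _ hr, intCoeff_of_neg _ hr, intCoeff_of_neg _ (by omega), mul_zero,
      add_zero]
  lift r to ℕ using hr
  rw [add_mul, one_mul, mul_assoc, add_comm, intCoeff_natCast, intCoeff_natCast, map_add,
    PowerSeries.coeff_C_mul]
  cases r with
  | zero => simp [intCoeff_of_neg]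
  | succ r =>
    rw [PowerSeries.coeff_succ_X_mul, Nat.cast_succ, add_sub_cancel_right, intCoeff_natCast]

/-- The Jacobi-Trudi matrix `(F_{μ_i - i + j})` of a power series `F`. For the generating series
of the complete or the elementary symmetric polynomials its determinant is the Schur polynomial of
`μ` or of the transpose of `μ`; for constant `μ` it is a Toeplitz matrix. -/
def jacobiTrudi {M : ℕ} (F : A⟦X⟧) (μ : Fin M → ℤ) : Matrix (Fin M) (Fin M) A :=
  Matrix.of fun i j => intCoeff F (μ i - (i : ℕ) + (j : ℕ))

theorem jacobiTrudi_apply {M : ℕ} (F : A⟦X⟧) (μ : Fin M → ℤ) (i j : Fin M) :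
    jacobiTrudi F μ i j = intCoeff F (μ i - (i : ℕ) + (j : ℕ)) := rfl

theorem map_det_jacobiTrudi {B : Type*} [CommRing B] (f : A →+* B) {M : ℕ} (F : A⟦X⟧)
    (μ : Fin M → ℤ) : f (jacobiTrudi F μ).det = (jacobiTrudi (F.map f) μ).det := by
  rw [f.map_det]
  congr 1
  ext i j
  exact map_intCoeff f F _

theorem det_jacobiTrudi_eq_sum {M : ℕ} (F : A⟦X⟧) (μ : Fin M → ℤ) :
    (jacobiTrudi F μ).det =
      ∑ w : Equiv.Perm (Fin M), ((Equiv.Perm.sign w : ℤ) : A) *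
        ∏ i, intCoeff F (μ i - (i : ℕ) + (w i : ℕ)) := by
  rw [← Matrix.det_transpose, Matrix.det_apply']
  rfl

theorem det_jacobiTrudi_zero {M : ℕ} {F : A⟦X⟧} (hF : PowerSeries.coeff 0 F = 1) :
    (jacobiTrudi F (0 : Fin M → ℤ)).det = 1 := by
  rw [Matrix.det_of_isUpperTriangular]
  · refine Finset.prod_eq_one fun i _ => ?_
    rw [jacobiTrudi_apply, Pi.zero_apply, zero_sub, neg_add_cancel, ← hF]
    exact intCoeff_natCast F 0
  · intro i j (hij : j < i)
    exact intCoeff_of_neg F (by simpa using Fin.lt_def.1 hij)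

theorem det_jacobiTrudi_snoc_zero {M : ℕ} {F : A⟦X⟧} (hF : PowerSeries.coeff 0 F = 1)
    (μ : Fin M → ℤ) :
    (jacobiTrudi F (Fin.snoc μ 0 : Fin (M + 1) → ℤ)).det = (jacobiTrudi F μ).det := by
  have hrow (j : Fin (M + 1)) : jacobiTrudi F (Fin.snoc μ 0 : Fin (M + 1) → ℤ) (Fin.last M) j =
      if j = Fin.last M then 1 else 0 := by
    rw [jacobiTrudi_apply, Fin.snoc_last, Fin.val_last, zero_sub]
    split_ifs with hj
    · rw [hj, Fin.val_last, neg_add_cancel, ← hF]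
      exact intCoeff_natCast F 0
    · have := Fin.val_lt_last hj
      exact intCoeff_of_neg F (by omega)
  have hminor : (jacobiTrudi F (Fin.snoc μ 0 : Fin (M + 1) → ℤ)).submatrix
      (Fin.last M).succAbove (Fin.last M).succAbove = jacobiTrudi F μ := by
    ext i j
    simp [jacobiTrudi_apply]
  rw [Matrix.det_succ_row _ (Fin.last M), Finset.sum_eq_single (Fin.last M) (fun j _ hj => by
    rw [hrow, if_neg hj, mul_zero, zero_mul]) (by simp), hrow, if_pos rfl, hminor, mul_one,
    Even.neg_one_pow ⟨_, rfl⟩, one_mul]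

theorem jacobiTrudi_zero_mul {M : ℕ} (F G : A⟦X⟧) :
    jacobiTrudi F (0 : Fin M → ℤ) * jacobiTrudi G 0 = jacobiTrudi (F * G) 0 := by
  ext i j
  have hG (b : ℕ) (hb : (j : ℕ) + 1 ≤ b) (hb' : (b : ℤ) ≤ 0 - (i : ℕ) + (j : ℕ)) :
      PowerSeries.coeff b G = 0 := by omega
  simp only [Matrix.mul_apply, jacobiTrudi_apply, Pi.zero_apply]
  rw [intCoeff_mul hG, ← Finset.sum_range_reflect, Fin.sum_univ_eq_sum_range
      (fun s => intCoeff F (0 - (i : ℕ) + s) * intCoeff G (0 - s + (j : ℕ))) M]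
  refine (Finset.sum_subset_zero_on_sdiff (Finset.range_subset_range.2 j.2) (fun s hs => ?_)
    fun s hs => ?_).symm
  · rw [intCoeff_of_neg G (by simp at hs; omega), mul_zero]
  · have hs := Finset.mem_range_succ_iff.1 hs
    rw [← intCoeff_natCast G]
    congr 2 <;> push_cast [Nat.cast_sub hs] <;> ring

theorem det_jacobiTrudi_one {F G : A⟦X⟧} (hFG : F * G = 1) (hF : PowerSeries.coeff 0 F = 1)
    (r : ℕ) :
    (jacobiTrudi F (1 : Fin r → ℤ)).det = (-1) ^ r * PowerSeries.coeff r G := by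
  have hone : jacobiTrudi F (0 : Fin (r + 1) → ℤ) * jacobiTrudi G 0 = 1 := by
    rw [jacobiTrudi_zero_mul, hFG]
    ext i j
    simp [jacobiTrudi_apply, intCoeff_one, Matrix.one_apply, Fin.ext_iff, neg_add_eq_zero]
  have hadj : (jacobiTrudi F (0 : Fin (r + 1) → ℤ)).adjugate = jacobiTrudi G 0 := by
    rw [← mul_one (Matrix.adjugate _), ← hone, ← mul_assoc, Matrix.adjugate_mul,
      det_jacobiTrudi_zero hF, one_smul, one_mul]
  have hminor : (jacobiTrudi F (0 : Fin (r + 1) → ℤ)).submatrix (Fin.last r).succAbove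
      (Fin.succAbove 0) = jacobiTrudi F 1 := by
    ext i j
    simp only [Matrix.submatrix_apply, jacobiTrudi_apply, Fin.succAbove_last, Fin.succAbove_zero,
      Fin.val_castSucc, Fin.val_succ, Pi.zero_apply, Pi.one_apply]
    congr 1
    push_cast
    ring
  have hcorner := congr_fun₂ hadj 0 (Fin.last r)
  rw [Matrix.adjugate_fin_succ_eq_det_submatrix, hminor] at hcorner
  simp only [jacobiTrudi_apply, Fin.val_last, Fin.val_zero, Pi.zero_apply, add_zero, Nat.cast_zero,
    sub_zero, zero_add, intCoeff_natCast] at hcorner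
  rw [← hcorner, ← mul_assoc, ← mul_pow, neg_one_mul, neg_neg, one_pow, one_mul]

/-- The sequence `μ` with one box removed from every row in `S`. -/
def removeBoxes {M : ℕ} (μ : Fin M → ℤ) (S : Finset (Fin M)) (i : Fin M) : ℤ :=
  μ i - if i ∈ S then 1 else 0

theorem det_jacobiTrudi_one_add_C_mul_X_mul {M : ℕ} (a : A) (F : A⟦X⟧) (μ : Fin M → ℤ) :
    (jacobiTrudi ((1 + PowerSeries.C a * PowerSeries.X) * F) μ).det =
      ∑ S : Finset (Fin M), a ^ S.card * (jacobiTrudi F (removeBoxes μ S)).det := by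
  have hexpand := MultilinearMap.map_add_univ (Matrix.detRowAlternating (R := A)).toMultilinearMap
    (fun i j : Fin M => a * intCoeff F (μ i - (i : ℕ) + (j : ℕ) - 1))
    (fun i j : Fin M => intCoeff F (μ i - (i : ℕ) + (j : ℕ)))
  refine .trans (congrArg Matrix.det ?_) (hexpand.trans (Finset.sum_congr rfl fun S _ => ?_))
  · ext i j
    exact intCoeff_one_add_C_mul_X_mul a F _
  have hrows := Matrix.det_mul_column (fun i => if i ∈ S then a else 1)
    (jacobiTrudi F (removeBoxes μ S))
  rw [Finset.prod_ite_mem, Finset.univ_inter, Finset.prod_const] at hrows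
  rw [← hrows]
  refine congrArg Matrix.det (Matrix.ext fun i j => ?_)
  rw [Matrix.of_apply, jacobiTrudi_apply, removeBoxes]
  by_cases hi : i ∈ S
  · rw [Finset.piecewise_eq_of_mem _ _ _ hi, if_pos hi, if_pos hi]
    congr 2
    ring
  · rw [Finset.piecewise_eq_of_notMem _ _ _ hi, if_neg hi, if_neg hi, one_mul, sub_zero]

theorem det_jacobiTrudi_eq_zero_of_last_neg {M : ℕ} (F : A⟦X⟧) {μ : Fin (M + 1) → ℤ}
    (hμ : μ (Fin.last M) < 0) : (jacobiTrudi F μ).det = 0 := by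
  refine Matrix.det_eq_zero_of_row_eq_zero (Fin.last M) fun j => intCoeff_of_neg F ?_
  have := j.2
  rw [Fin.val_last]
  omega

theorem det_jacobiTrudi_eq_zero_of_succ {M : ℕ} (F : A⟦X⟧) {μ : Fin (M + 1) → ℤ} {i : Fin M}
    (hμ : μ i.succ = μ i.castSucc + 1) : (jacobiTrudi F μ).det = 0 := by
  refine Matrix.det_zero_of_row_eq i.castSucc_lt_succ.ne (funext fun j => ?_)
  rw [jacobiTrudi_apply, jacobiTrudi_apply, hμ, Fin.val_castSucc, Fin.val_succ]
  congr 1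
  push_cast
  ring

theorem det_jacobiTrudi_removeBoxes_eq_zero {M : ℕ} (F : A⟦X⟧) {μ : Fin M → ℤ} (hμ : Antitone μ)
    {S : Finset (Fin M)}
    (hS : ¬(Antitone (removeBoxes μ S) ∧ ∀ i, 0 ≤ removeBoxes μ S i)) :
    (jacobiTrudi F (removeBoxes μ S)).det = 0 := by
  cases M with
  | zero => exact absurd ⟨fun i => i.elim0, fun i => i.elim0⟩ hS
  | succ M =>
    by_cases hanti : Antitone (removeBoxes μ S)
    · refine det_jacobiTrudi_eq_zero_of_last_neg F ?_
      by_contra! hlast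
      exact hS ⟨hanti, fun i => hlast.trans (hanti (Fin.le_last i))⟩
    · rw [Fin.antitone_iff_succ_le] at hanti
      push Not at hanti
      obtain ⟨i, hi⟩ := hanti
      refine det_jacobiTrudi_eq_zero_of_succ F (i := i) ?_
      have := hμ i.castSucc_lt_succ.le
      unfold removeBoxes at hi ⊢
      split_ifs at hi ⊢ <;> omega

end JacobiTrudi

/-! ### Symmetric functions and alternants -/

section Alternants

variable {R ι : Type*} [CommRing R] [Fintype ι]

/-- The polynomial `∏ (1 - ξ_i X)`, the inverse of the generating series of the complete symmetric
functions of `ξ`. -/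
def prodOneSub (ξ : ι → R) : R[X] :=
  ∏ i, (1 - Polynomial.C (ξ i) * Polynomial.X)

theorem coeff_zero_prodOneSub (ξ : ι → R) : (prodOneSub ξ).coeff 0 = 1 := by
  rw [Polynomial.coeff_zero_eq_eval_zero, prodOneSub, Polynomial.eval_prod]
  simp

theorem natDegree_one_sub_C_mul_X_le (a : R) :
    (1 - Polynomial.C a * Polynomial.X).natDegree ≤ 1 := by
  compute_degree

theorem natDegree_prodOneSub_le (ξ : ι → R) : (prodOneSub ξ).natDegree ≤ Fintype.card ι := by
  refine (Polynomial.natDegree_prod_le _ _).trans ?_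
  simpa using Finset.sum_le_card_nsmul Finset.univ _ 1
    fun i _ => natDegree_one_sub_C_mul_X_le (ξ i)

theorem coeff_card_prodOneSub (ξ : ι → R) :
    (prodOneSub ξ).coeff (Fintype.card ι) = (-1) ^ Fintype.card ι * ∏ i, ξ i := by
  have h := Polynomial.coeff_prod_of_natDegree_le Finset.univ
    (fun i => 1 - Polynomial.C (ξ i) * Polynomial.X) 1
    fun i _ => natDegree_one_sub_C_mul_X_le (ξ i)
  rw [Finset.card_univ, mul_one] at h
  rw [prodOneSub, h]
  simp [Polynomial.coeff_one, Finset.prod_neg]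

/-- The generating series `∏ 1 / (1 - ξ_i X)` of the complete symmetric functions of `ξ`. -/
def hsymmSeries (ξ : ι → R) : R⟦X⟧ :=
  ∏ i, PowerSeries.mk fun r => ξ i ^ r

theorem coeff_zero_hsymmSeries (ξ : ι → R) : PowerSeries.coeff 0 (hsymmSeries ξ) = 1 := by
  simp [hsymmSeries, PowerSeries.coeff_zero_eq_constantCoeff_apply, map_prod]

theorem one_sub_C_mul_X_mul_mk_pow (a : R) :
    (1 - PowerSeries.C a * PowerSeries.X) * PowerSeries.mk (a ^ ·) = 1 := by
  ext r
  cases r with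
  | zero => simp
  | succ r =>
    rw [sub_mul, one_mul, mul_assoc, map_sub, PowerSeries.coeff_C_mul,
      PowerSeries.coeff_succ_X_mul, PowerSeries.coeff_mk, PowerSeries.coeff_mk, ← pow_succ',
      sub_self, PowerSeries.coeff_one, if_neg r.succ_ne_zero]

theorem coe_prodOneSub (ξ : ι → R) :
    (prodOneSub ξ : R⟦X⟧) = ∏ i, (1 - PowerSeries.C (ξ i) * PowerSeries.X) := by
  rw [prodOneSub, ← Polynomial.coeToPowerSeries.ringHom_apply, map_prod]
  simp

theorem prodOneSub_mul_hsymmSeries (ξ : ι → R) : (prodOneSub ξ : R⟦X⟧) * hsymmSeries ξ = 1 := by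
  rw [coe_prodOneSub, hsymmSeries, ← Finset.prod_mul_distrib]
  exact Finset.prod_eq_one fun i _ => one_sub_C_mul_X_mul_mk_pow (ξ i)

theorem coeff_eq_mul_coeff_hsymmSeries {ξ : ι → R} {G : R⟦X⟧} {a c : R} {L r : ℕ}
    (hG : (prodOneSub ξ : R⟦X⟧) * G =
      PowerSeries.C a * (1 - PowerSeries.C c * PowerSeries.X ^ L)) (hr : r < L) :
    PowerSeries.coeff r G = a * PowerSeries.coeff r (hsymmSeries ξ) := by
  have hGH : G = PowerSeries.C a * hsymmSeries ξ -
      PowerSeries.C (a * c) * hsymmSeries ξ * PowerSeries.X ^ L := by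
    rw [map_mul]
    linear_combination hsymmSeries ξ * hG - G * prodOneSub_mul_hsymmSeries ξ
  rw [hGH, map_sub, PowerSeries.coeff_C_mul, PowerSeries.coeff_mul_X_pow', if_neg hr.not_ge,
    sub_zero]

/-- `1` minus the weighted permutation matrix of the cycle `i ↦ i + 1`. -/
def oneSubCycle {N : ℕ} (w : Fin (N + 1) → R) : Matrix (Fin (N + 1)) (Fin (N + 1)) R :=
  Matrix.of fun i j => (if i = j then 1 else 0) - if i + 1 = j then w i else 0

theorem oneSubCycle_apply {N : ℕ} (w : Fin (N + 1) → R) (i j : Fin (N + 1)) :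
    oneSubCycle w i j = (if i = j then 1 else 0) - if i + 1 = j then w i else 0 := rfl

theorem det_oneSubCycle {N : ℕ} (w : Fin (N + 1) → R) : (oneSubCycle w).det = 1 - ∏ i, w i := by
  cases N with
  | zero => simp [oneSubCycle]
  | succ N =>
    have hupper : ((oneSubCycle w).submatrix (Fin.succAbove 0) Fin.succ).det = 1 := by
      rw [Matrix.det_of_isUpperTriangular]
      · exact Finset.prod_eq_one fun i _ => by simp [oneSubCycle_apply]
      · intro i j (hij : j < i)
        have hji : j.castSucc ≠ i.succ :=
          (Fin.castSucc_lt_castSucc_iff.2 hij |>.trans Fin.castSucc_lt_succ).ne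
        have hcycle : i.succ + 1 ≠ j.succ := fun h => hji <| add_right_cancel (b := 1) <| by
          rw [h, Fin.coeSucc_eq_succ]
        simp [oneSubCycle_apply, hij.ne', hcycle]
    have hlower : ((oneSubCycle w).submatrix (Fin.last (N + 1)).succAbove Fin.succ).det =
        ∏ j : Fin (N + 1), -w j.castSucc := by
      rw [Matrix.det_of_isLowerTriangular]
      · refine Finset.prod_congr rfl fun i _ => ?_
        simp [oneSubCycle_apply, Fin.castSucc_lt_succ.ne]
      · intro i j (hij : i < j)
        have hji : i.castSucc ≠ j.succ := (Fin.castSucc_lt_succ.trans (by simpa using hij)).ne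
        simp [oneSubCycle_apply, hij.ne, hji]
    have hcol : ∀ i, i ≠ 0 ∧ i ≠ Fin.last (N + 1) → oneSubCycle w i 0 = 0 := by
      rintro i ⟨hi0, hi⟩
      rw [oneSubCycle_apply, if_neg hi0, if_neg fun h => hi ?_, sub_zero]
      exact add_right_cancel (h.trans (Fin.last_add_one _).symm)
    have h0 : oneSubCycle w 0 0 = 1 := by simp [oneSubCycle_apply]
    have hlast : oneSubCycle w (Fin.last (N + 1)) 0 = -w (Fin.last (N + 1)) := by
      simp [oneSubCycle_apply, (Fin.last_pos (n := N)).ne']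
    rw [Matrix.det_succ_column_zero, Finset.sum_eq_add 0 (Fin.last (N + 1))
      Fin.last_pos.ne (fun i _ hi => by rw [hcol i hi, mul_zero, zero_mul])
      (by simp) (by simp), hupper, hlower, h0, hlast, Fin.prod_univ_castSucc w, Finset.prod_neg]
    have hsign : ((-1 : R) ^ (N + 1)) * (-1) ^ (N + 1) = 1 := by
      rw [← mul_pow, neg_one_mul, neg_neg, one_pow]
    simp only [Fin.val_last, Finset.card_univ, Fintype.card_fin, Fin.val_zero, pow_zero]
    linear_combination (-w (Fin.last (N + 1)) * ∏ j : Fin (N + 1), w j.castSucc) * hsign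

variable [DecidableEq ι]

/-- The alternant `det (ξ_i ^ l_j)`. -/
def alternant (ξ : ι → R) (l : ι → ℕ) : R :=
  (Matrix.of fun i j => ξ i ^ l j).det

/-- The matrix with entries `∑_{α ≤ b_j} ξ_i ^ (l_j + α) X ^ α`, whose determinant is the generating
function of the alternants with exponents `l + ε`, `ε ≤ b`. -/
def pieriMatrix (ξ : ι → R) (l b : ι → ℕ) : Matrix ι ι R[X] :=
  Matrix.of fun i j =>
    ∑ α ∈ Finset.range (b j + 1), Polynomial.X ^ α * Polynomial.C (ξ i ^ (l j + α))

theorem det_pieriMatrix (ξ : ι → R) (l b : ι → ℕ) :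
    (pieriMatrix ξ l b).det = ∑ ε ∈ Fintype.piFinset fun j => Finset.range (b j + 1),
      Polynomial.X ^ (∑ j, ε j) * Polynomial.C (alternant ξ fun j => l j + ε j) := by
  have hexpand := MultilinearMap.map_sum_finset
    (Matrix.detRowAlternating (n := ι) (R := R[X])).toMultilinearMap
    (fun j α i => Polynomial.X ^ α * Polynomial.C (ξ i ^ (l j + α)))
    (fun j => Finset.range (b j + 1))
  have hrows : (pieriMatrix ξ l b).transpose = fun j => ∑ α ∈ Finset.range (b j + 1),
      fun i => (Polynomial.X ^ α * Polynomial.C (ξ i ^ (l j + α)) : R[X]) := by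
    ext j i : 2
    rw [Finset.sum_apply]
    rfl
  rw [← Matrix.det_transpose, hrows]
  refine hexpand.trans (Finset.sum_congr rfl fun ε _ => ?_)
  have hscale := Matrix.det_mul_column (fun j => (Polynomial.X : R[X]) ^ ε j)
    ((Matrix.of fun i j => ξ i ^ (l j + ε j)).transpose.map Polynomial.C)
  rw [Finset.prod_pow_eq_pow_sum] at hscale
  rw [alternant, ← Matrix.det_transpose, RingHom.map_det]
  exact hscale

theorem coeff_det_pieriMatrix (ξ : ι → R) (l b : ι → ℕ) (r : ℕ) :
    (pieriMatrix ξ l b).det.coeff r =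
      ∑ ε ∈ Finset.piAntidiag Finset.univ r with ∀ j, ε j ≤ b j,
        alternant ξ fun j => l j + ε j := by
  rw [det_pieriMatrix, Polynomial.finsetSum_coeff]
  simp only [Polynomial.coeff_mul_C, Polynomial.coeff_X_pow, ite_mul, one_mul, zero_mul]
  rw [← Finset.sum_filter]
  refine Finset.sum_congr ?_ fun _ _ => rfl
  ext ε
  simp only [Finset.mem_filter, Fintype.mem_piFinset, Finset.mem_range_succ_iff,
    Finset.mem_piAntidiag, Finset.mem_univ, implies_true, and_true]
  exact ⟨fun h => ⟨h.2.symm, h.1⟩, fun h => ⟨h.2, h.1.symm⟩⟩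

omit [Fintype ι] [DecidableEq ι] in
theorem one_sub_C_mul_X_mul_pieriMatrix (ξ : ι → R) (l b : ι → ℕ) (i j : ι) :
    (1 - Polynomial.C (ξ i) * Polynomial.X) * pieriMatrix ξ l b i j =
      Polynomial.C (ξ i ^ l j) -
        Polynomial.C (ξ i ^ (l j + b j + 1)) * Polynomial.X ^ (b j + 1) := by
  have hgeom : pieriMatrix ξ l b i j = Polynomial.C (ξ i ^ l j) *
      ∑ α ∈ Finset.range (b j + 1), (Polynomial.C (ξ i) * Polynomial.X) ^ α := by
    rw [pieriMatrix, Matrix.of_apply, Finset.mul_sum]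
    refine Finset.sum_congr rfl fun α _ => ?_
    rw [pow_add, Polynomial.C_mul, mul_pow, Polynomial.C_pow, Polynomial.C_pow]
    ring
  rw [hgeom, mul_left_comm, mul_neg_geom_sum, add_assoc, pow_add (ξ i), Polynomial.C_mul, mul_pow,
    Polynomial.C_pow, Polynomial.C_pow]
  ring

theorem prodOneSub_mul_det_pieriMatrix {N : ℕ} {ξ : Fin (N + 1) → R} {l b : Fin (N + 1) → ℕ}
    {a : Fin (N + 1) → R}
    (ha : ∀ i j, ξ i ^ (l (j + 1) + b (j + 1) + 1) = a j * ξ i ^ l j) :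
    prodOneSub ξ * (pieriMatrix ξ l b).det = Polynomial.C (alternant ξ l) *
      (1 - Polynomial.C (∏ j, a j) * Polynomial.X ^ ∑ j, (b j + 1)) := by
  have hfactor : Matrix.diagonal (fun i => 1 - Polynomial.C (ξ i) * Polynomial.X) *
      pieriMatrix ξ l b = (Matrix.of fun i j => ξ i ^ l j).map Polynomial.C *
        oneSubCycle fun j => Polynomial.C (a j) * Polynomial.X ^ (b (j + 1) + 1) := by
    ext1 i j
    obtain ⟨j, rfl⟩ := (Equiv.addRight (1 : Fin (N + 1))).surjective j
    rw [Equiv.coe_addRight, Matrix.diagonal_mul, one_sub_C_mul_X_mul_pieriMatrix, ha,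
      Matrix.mul_apply]
    simp only [oneSubCycle_apply, Matrix.map_apply, Matrix.of_apply, mul_sub, mul_ite, mul_one,
      mul_zero, Finset.sum_sub_distrib, Finset.sum_ite_eq', Finset.mem_univ, if_true,
      add_left_inj, Polynomial.C_mul]
    ring
  have hsum : ∑ j, (b (j + 1) + 1) = ∑ j, (b j + 1) :=
    Equiv.sum_comp (Equiv.addRight (1 : Fin (N + 1))) fun j => b j + 1
  have hdet := congrArg Matrix.det hfactor
  rw [Matrix.det_mul, Matrix.det_mul, Matrix.det_diagonal, det_oneSubCycle,
    Finset.prod_mul_distrib, ← map_prod, Finset.prod_pow_eq_pow_sum, hsum] at hdet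
  rw [prodOneSub, hdet, alternant, RingHom.map_det]
  rfl

theorem alternant_add_const (ξ : ι → R) (l : ι → ℕ) (t : ℕ) :
    alternant ξ (fun j => l j + t) = (∏ i, ξ i) ^ t * alternant ξ l := by
  rw [alternant, alternant, ← Finset.prod_pow, ← Matrix.det_mul_column]
  congr 1
  ext i j
  simp [pow_add, mul_comm]

theorem prodOneSub_removeNth_mul_hsymmSeries {N : ℕ} (ξ : Fin (N + 1) → R) (i : Fin (N + 1)) :
    (prodOneSub (i.removeNth ξ) : R⟦X⟧) * hsymmSeries ξ = PowerSeries.mk (ξ i ^ ·) := by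
  have hsplit : hsymmSeries ξ = PowerSeries.mk (ξ i ^ ·) * hsymmSeries (i.removeNth ξ) :=
    Fin.prod_univ_succAbove _ i
  rw [hsplit, mul_left_comm, prodOneSub_mul_hsymmSeries, mul_one]

theorem pow_eq_sum_intCoeff_hsymmSeries {N : ℕ} (ξ : Fin (N + 1) → R) (i : Fin (N + 1)) (l : ℕ) :
    ξ i ^ l = ∑ m : Fin (N + 1), intCoeff (hsymmSeries ξ) ((l : ℤ) - (m : ℕ)) *
      (prodOneSub (i.removeNth ξ)).coeff m := by
  have hdeg (b : ℕ) (hb : N + 1 ≤ b) (_ : (b : ℤ) ≤ l) :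
      PowerSeries.coeff b (prodOneSub (i.removeNth ξ) : R⟦X⟧) = 0 := by
    have hle := natDegree_prodOneSub_le (i.removeNth ξ)
    rw [Fintype.card_fin] at hle
    rw [Polynomial.coeff_coe, Polynomial.coeff_eq_zero_of_natDegree_lt (by omega)]
  have hcoeff := intCoeff_mul (F := hsymmSeries ξ) hdeg
  rw [mul_comm, prodOneSub_removeNth_mul_hsymmSeries, intCoeff_natCast,
    PowerSeries.coeff_mk] at hcoeff
  rw [hcoeff, ← Fin.sum_univ_eq_sum_range fun b => intCoeff (hsymmSeries ξ) ((l : ℤ) - b) *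
    PowerSeries.coeff b (prodOneSub (i.removeNth ξ) : R⟦X⟧)]
  simp only [Polynomial.coeff_coe]

theorem alternant_add_rho_eq_det_mul {N : ℕ} (ξ : Fin (N + 1) → R) (lam : Fin (N + 1) → ℕ) :
    alternant ξ (fun j => lam j + (N - j)) = (jacobiTrudi (hsymmSeries ξ) fun j => lam j).det *
      (Matrix.of fun j i : Fin (N + 1) => (prodOneSub (i.removeNth ξ)).coeff j.rev).det := by
  rw [alternant, ← Matrix.det_transpose, ← Matrix.det_mul]
  congr 1
  ext j i
  rw [Matrix.transpose_apply, Matrix.of_apply, Matrix.mul_apply, pow_eq_sum_intCoeff_hsymmSeries,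
    ← Equiv.sum_comp Fin.revPerm]
  refine Finset.sum_congr rfl fun m _ => ?_
  rw [jacobiTrudi_apply, Matrix.of_apply, Fin.revPerm_apply, Fin.val_rev]
  congr 2
  omega

theorem alternant_snoc_zero_add_rho {N : ℕ} (ξ : Fin (N + 1) → R) (lam : Fin N → ℕ) :
    alternant ξ (fun j => (Fin.snoc lam 0 : Fin (N + 1) → ℕ) j + (N - j)) =
      (jacobiTrudi (hsymmSeries ξ) fun j => lam j).det * alternant ξ (fun j => N - j) := by
  have hrho := alternant_add_rho_eq_det_mul ξ 0
  have hzero : (fun _ : Fin (N + 1) => ((0 : ℕ) : ℤ)) = 0 := rfl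
  have hsnoc : (fun j => (((Fin.snoc lam 0 : Fin (N + 1) → ℕ) j : ℕ) : ℤ)) =
      (Fin.snoc (fun j => (lam j : ℤ)) 0 : Fin (N + 1) → ℤ) := by
    ext j
    cases j using Fin.lastCases <;> simp
  simp only [Pi.zero_apply, zero_add] at hrho
  rw [hzero, det_jacobiTrudi_zero (coeff_zero_hsymmSeries ξ), one_mul] at hrho
  rw [alternant_add_rho_eq_det_mul, hsnoc, det_jacobiTrudi_snoc_zero (coeff_zero_hsymmSeries ξ),
    hrho]

theorem alternant_rho_ne_zero [IsDomain R] {N : ℕ} {ξ : Fin (N + 1) → R}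
    (hξ : Function.Injective ξ) : alternant ξ (fun j => N - j) ≠ 0 := by
  have hperm := Matrix.det_permute' Fin.revPerm (Matrix.vandermonde ξ)
  have hrev : (Matrix.vandermonde ξ).submatrix id Fin.revPerm =
      Matrix.of fun i (j : Fin (N + 1)) => ξ i ^ (N - (j : ℕ)) := by
    ext i j
    rw [Matrix.submatrix_apply, Matrix.vandermonde_apply, Fin.revPerm_apply, Fin.val_rev,
      Nat.add_sub_add_right]
    rfl
  rw [alternant, ← hrev, hperm]
  exact mul_ne_zero ((Units.isUnit _).map (Int.castRingHom R)).ne_zero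
    (Matrix.det_vandermonde_ne_zero_iff.2 hξ)

end Alternants

/-! ### The action on basis vectors -/

section Action

variable {N : ℕ}

theorem phiStar_single (i : Fin (N + 1)) (m : Fin (N + 1) → ℕ) :
    phiStar i (Finsupp.single m 1) = Finsupp.single (m + Pi.single i 1) 1 := by
  rw [phiStar, Finsupp.linearCombination_single, one_smul]
  congr 1
  ext j
  rcases eq_or_ne j i with rfl | h <;> simp [*]

theorem phi_single (i : Fin (N + 1)) (m : Fin (N + 1) → ℕ) :
    phi i (Finsupp.single m 1) = if 1 ≤ m i then Finsupp.single (m - Pi.single i 1) 1 else 0 := by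
  rw [phi, Finsupp.linearCombination_single, one_smul]
  congr 2
  ext j
  rcases eq_or_ne j i with rfl | h <;> simp [*]

theorem phiStar_pow_single (i : Fin (N + 1)) (m : Fin (N + 1) → ℕ) (r : ℕ) :
    (phiStar i ^ r) (Finsupp.single m 1) = Finsupp.single (m + Pi.single i r) 1 := by
  induction r with
  | zero => simp
  | succ r ih =>
    rw [pow_succ', Module.End.mul_apply, ih, phiStar_single, add_assoc, ← Pi.single_add]

theorem phi_pow_single (i : Fin (N + 1)) (m : Fin (N + 1) → ℕ) (r : ℕ) :
    (phi i ^ r) (Finsupp.single m 1) =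
      if r ≤ m i then Finsupp.single (m - Pi.single i r) 1 else 0 := by
  induction r with
  | zero => simp
  | succ r ih =>
    rw [pow_succ', Module.End.mul_apply, ih, apply_ite (phi i), map_zero, phi_single, tsub_tsub,
      ← Pi.single_add, Pi.sub_apply, Pi.single_eq_same, ← ite_and]
    congr 1
    exact propext (by omega)

theorem commute_phiStar_phi {i j : Fin (N + 1)} (hij : i ≠ j) : Commute (phiStar i) (phi j) := by
  refine Finsupp.lhom_ext' fun m => LinearMap.ext_ring ?_
  have hcomm (hm : 1 ≤ m j) :
      m - Pi.single j 1 + Pi.single i 1 = m + Pi.single i 1 - Pi.single j 1 := by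
    rw [tsub_add_eq_add_tsub]
    intro a
    rcases eq_or_ne a j with rfl | ha <;> simp [*]
  simp only [LinearMap.comp_apply, Finsupp.lsingle_apply, Module.End.mul_apply, phi_single,
    phiStar_single, Pi.add_apply, Pi.single_eq_of_ne' hij, add_zero, apply_ite (phiStar i),
    map_zero]
  split_ifs with hm
  · rw [hcomm hm]
  · rfl

theorem plactic_pow_single (j : Fin N) (m : Fin (N + 1) → ℕ) (r : ℕ) :
    (plactic j ^ r) (Finsupp.single m 1) = if r ≤ m j.castSucc then
      Finsupp.single (m - Pi.single j.castSucc r + Pi.single j.succ r) 1 else 0 := by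
  rw [plactic, (commute_phiStar_phi j.castSucc_lt_succ.ne').mul_pow, Module.End.mul_apply,
    phi_pow_single, apply_ite (phiStar j.succ ^ r), map_zero, phiStar_pow_single]

theorem list_sum_single_eq_zero {α β : Type*} [DecidableEq β] {l : List α} {f : α → β}
    (g : α → ℕ) {b : β} (hl : ∀ a ∈ l, f a ≠ b) :
    (l.map fun a => (Pi.single (f a) (g a) : β → ℕ)).sum b = 0 := by
  rw [Pi.list_sum_apply, List.map_map]
  refine List.sum_eq_zero fun x hx => ?_
  obtain ⟨a, ha, rfl⟩ := List.mem_map.1 hx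
  exact Pi.single_eq_of_ne' (hl a ha) _

theorem list_prod_plactic_single (ε : Fin N → ℕ) {l : List (Fin N)} (hl : l.Pairwise (· < ·))
    (m : Fin (N + 1) → ℕ) :
    (l.map fun j => plactic j ^ ε j).prod (Finsupp.single m 1) =
      if ∀ j ∈ l, ε j ≤ m j.castSucc then
        Finsupp.single (m - (l.map fun j => Pi.single j.castSucc (ε j)).sum +
          (l.map fun j => Pi.single j.succ (ε j)).sum) 1
      else 0 := by
  induction l with
  | nil => simp
  | cons j l ih =>
    obtain ⟨hj, hl⟩ := List.pairwise_cons.1 hl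
    have hout :
        (l.map fun i => (Pi.single i.castSucc (ε i) : Fin (N + 1) → ℕ)).sum j.castSucc = 0 :=
      list_sum_single_eq_zero _ fun i hi => by simpa using (hj i hi).ne'
    have hin : (l.map fun i => (Pi.single i.succ (ε i) : Fin (N + 1) → ℕ)).sum j.castSucc = 0 :=
      list_sum_single_eq_zero _ fun i hi =>
        (Fin.castSucc_lt_castSucc_iff.2 (hj i hi) |>.trans i.castSucc_lt_succ).ne'
    rw [List.map_cons, List.prod_cons, Module.End.mul_apply, ih hl,
      apply_ite (plactic j ^ ε j), map_zero, plactic_pow_single, ← ite_and]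
    simp only [List.forall_mem_cons, List.map_cons, List.sum_cons, Pi.add_apply, Pi.sub_apply,
      hout, hin, tsub_zero, add_zero, and_comm (b := ε j ≤ _)]
    congr 2
    ext i
    rcases eq_or_ne i j.castSucc with rfl | hi
    · simp [hout, hin]
    · simp only [Pi.add_apply, Pi.sub_apply, Pi.single_eq_of_ne hi]
      omega

/-- The configuration obtained from `m` when, simultaneously for all sites `i` in the cyclic order,
`ε (i + 1)` particles hop from `i` to `i + 1`. -/
def inflow (m ε : Fin (N + 1) → ℕ) (i : Fin (N + 1)) : ℕ :=
  m i - ε (i + 1) + ε i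

theorem sum_single_castSucc_add_single_last (ε : Fin (N + 1) → ℕ) :
    ∑ j : Fin N, Pi.single j.castSucc (ε j.succ) + Pi.single (Fin.last N) (ε 0) =
      fun i => ε (i + 1) := by
  have hsum := Finset.univ_sum_single fun i => ε (i + 1)
  rw [Fin.sum_univ_castSucc] at hsum
  simpa only [Fin.coeSucc_eq_succ, Fin.last_add_one] using hsum

theorem sum_single_succ_add_single_zero (ε : Fin (N + 1) → ℕ) :
    ∑ j : Fin N, Pi.single j.succ (ε j.succ) + Pi.single 0 (ε 0) = ε :=
  (add_comm _ _).trans <| (Fin.sum_univ_succ _).symm.trans (Finset.univ_sum_single ε)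

theorem placticH_term_single (m ε : Fin (N + 1) → ℕ) :
    (phiStar 0 ^ ε 0 * (List.ofFn fun j : Fin N => plactic j ^ ε j.succ).prod *
      phi (Fin.last N) ^ ε 0 : Module.End ℂ (State N)) (Finsupp.single m 1) =
        if ∀ i, ε (i + 1) ≤ m i then Finsupp.single (inflow m ε) 1 else 0 := by
  have hcond : (∀ i, ε (i + 1) ≤ m i) ↔
      ε 0 ≤ m (Fin.last N) ∧ ∀ j ∈ List.finRange N, ε j.succ ≤
        (m - Pi.single (Fin.last N) (ε 0) : Fin (N + 1) → ℕ) j.castSucc := by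
    simp [Fin.forall_fin_succ', and_comm, (Fin.castSucc_lt_last _).ne]
  rw [Module.End.mul_apply, Module.End.mul_apply, phi_pow_single, List.ofFn_eq_map,
    apply_ite (List.prod _ : Module.End ℂ (State N)), map_zero,
    list_prod_plactic_single (fun j => ε j.succ) (List.pairwise_lt_finRange N),
    ← ite_and, apply_ite (phiStar 0 ^ ε 0), map_zero, phiStar_pow_single]
  simp only [← hcond, ← List.ofFn_eq_map, List.sum_ofFn]
  rw [tsub_tsub, add_comm (Pi.single _ _), sum_single_castSucc_add_single_last, add_assoc,
    sum_single_succ_add_single_zero]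
  rfl

theorem placticH_single (r : ℕ) (m : Fin (N + 1) → ℕ) :
    placticH N r (Finsupp.single m 1) =
      ∑ ε ∈ Finset.piAntidiag Finset.univ r with ∀ i, ε (i + 1) ≤ m i,
        Finsupp.single (inflow m ε) 1 := by
  simp only [placticH, LinearMap.sum_apply, Finset.sum_filter, placticH_term_single]

/-- The sum of the labels `m_i` with `j ≤ i < N`: the part `λ_j` when `m` is the tuple of Dynkin
labels of `λ`. -/
def tailSum (m : Fin (N + 1) → ℕ) (j : Fin (N + 1)) : ℕ :=
  ∑ i : Fin N with j ≤ i.castSucc, m i.castSucc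

theorem tailSum_last (m : Fin (N + 1) → ℕ) : tailSum m (Fin.last N) = 0 := by
  rw [tailSum, Finset.filter_false_of_mem fun i _ => i.castSucc_lt_last.not_ge, Finset.sum_empty]

theorem tailSum_castSucc (m : Fin (N + 1) → ℕ) (j : Fin N) :
    tailSum m j.castSucc = m j.castSucc + tailSum m j.succ := by
  have hinsert : (Finset.univ.filter fun i : Fin N => j.castSucc ≤ i.castSucc) =
      insert j (Finset.univ.filter fun i : Fin N => j.succ ≤ i.castSucc) := by
    ext i
    simp only [Finset.mem_filter, Finset.mem_univ, true_and, Finset.mem_insert, Fin.le_def,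
      Fin.val_castSucc, Fin.val_succ, Fin.ext_iff]
    omega
  rw [tailSum, hinsert, Finset.sum_insert (by simp [Fin.le_def]), tailSum]

theorem tailSum_zero_add (m : Fin (N + 1) → ℕ) : tailSum m 0 + m (Fin.last N) = ∑ i, m i := by
  rw [Fin.sum_univ_castSucc, tailSum]
  simp only [Fin.zero_le, Finset.filter_true]

theorem tailSum_antitone (m : Fin (N + 1) → ℕ) : Antitone (tailSum m) := fun _ _ hij =>
  Finset.sum_le_sum_of_subset (Finset.monotone_filter_right _ fun _ _ => hij.trans)

/-- The exponents of the alternant attached to `m`; for the Dynkin labels of a partition these are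
`λ_j + N - j`. -/
def expo (m : Fin (N + 1) → ℕ) (j : Fin (N + 1)) : ℕ :=
  tailSum m j + (N - j)

theorem expo_last (m : Fin (N + 1) → ℕ) : expo m (Fin.last N) = 0 := by
  rw [expo, tailSum_last, Fin.val_last, Nat.sub_self]

theorem expo_castSucc (m : Fin (N + 1) → ℕ) (j : Fin N) :
    expo m j.castSucc = m j.castSucc + 1 + expo m j.succ := by
  rw [expo, expo, tailSum_castSucc, Fin.val_castSucc, Fin.val_succ]
  omega

theorem expo_zero_add (m : Fin (N + 1) → ℕ) : expo m 0 + m (Fin.last N) = ∑ i, m i + N := by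
  rw [← tailSum_zero_add, expo, Fin.val_zero, Nat.sub_zero, add_right_comm]

theorem expo_inflow {m ε : Fin (N + 1) → ℕ} (hε : ∀ i, ε (i + 1) ≤ m i) (j : Fin (N + 1)) :
    expo (inflow m ε) j + ε (Fin.last N) = expo m j + ε j := by
  induction j using Fin.reverseInduction with
  | last => rw [expo_last, expo_last]
  | cast j ih =>
    have hj := hε j.castSucc
    rw [expo_castSucc, expo_castSucc, inflow]
    rw [Fin.coeSucc_eq_succ] at hj ⊢
    omega

end Action

/-! ### Bethe roots -/

section ElemPoly

variable {R : Type*} [CommRing R] {k : ℕ}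

/-- The polynomial `1 + x₁ X + ⋯ + x_k X ^ k`. In Bethe coordinates `x`, it is the generating
function of the elementary symmetric polynomials `e₀, …, e_k`. -/
def elemPoly (x : Fin k → R) : R[X] :=
  1 + ∑ i : Fin k, Polynomial.C (x i) * Polynomial.X ^ ((i : ℕ) + 1)

theorem coeff_zero_elemPoly (x : Fin k → R) : (elemPoly x).coeff 0 = 1 := by
  simp [elemPoly, Polynomial.finsetSum_coeff]

theorem coeff_succ_elemPoly (x : Fin k → R) (i : Fin k) :
    (elemPoly x).coeff ((i : ℕ) + 1) = x i := by
  simp [elemPoly, Polynomial.finsetSum_coeff, Polynomial.coeff_one, Polynomial.coeff_X_pow,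
    Fin.val_inj]

theorem natDegree_elemPoly_le (x : Fin k → R) : (elemPoly x).natDegree ≤ k := by
  refine Polynomial.natDegree_add_le_of_degree_le (by simp) ?_
  exact Polynomial.natDegree_sum_le_of_forall_le _ _ fun i _ =>
    (Polynomial.natDegree_C_mul_X_pow_le _ _).trans i.2

theorem elemPoly_coeff_succ {Q : R[X]} (hQ : Q.natDegree ≤ k) (hQ0 : Q.coeff 0 = 1) :
    (elemPoly fun i : Fin k => Q.coeff ((i : ℕ) + 1)) = Q := by
  ext r
  rcases r with - | r
  · rw [coeff_zero_elemPoly, hQ0]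
  · rcases lt_or_ge r k with hr | hr
    · exact coeff_succ_elemPoly _ ⟨r, hr⟩
    · rw [Polynomial.coeff_eq_zero_of_natDegree_lt ((natDegree_elemPoly_le _).trans_lt (by omega)),
        Polynomial.coeff_eq_zero_of_natDegree_lt (by omega)]

theorem map_elemPoly {S : Type*} [CommRing S] (f : R →+* S) (x : Fin k → R) :
    (elemPoly x : R⟦X⟧).map f = (elemPoly (f ∘ x) : S[X]) := by
  rw [← Polynomial.polynomial_map_coe]
  simp [elemPoly, Polynomial.map_sum]

end ElemPoly

/-- A solution of the Bethe equations in fermionic form: pairwise distinct numbers with product `1`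
and a common `(N + 1 + k)`-th power `c`. -/
structure IsBetheRoot {K : Type*} [Field K] {N : ℕ} (k : ℕ) (ξ : Fin (N + 1) → K) (c : K) :
    Prop where
  injective : Function.Injective ξ
  prod_eq_one : ∏ i, ξ i = 1
  pow_eq : ∀ i, ξ i ^ (N + 1 + k) = c

/-- The coordinates `(h₁(ξ), …, h_k(ξ))` of the point of the Bethe variety attached to `ξ`. -/
def betheCoord {R : Type*} [CommRing R] {N : ℕ} (k : ℕ) (ξ : Fin (N + 1) → R) (i : Fin k) : R :=
  PowerSeries.coeff (i + 1) (hsymmSeries ξ)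

section BetheRoot

variable {K : Type*} [Field K] {N k : ℕ} {ξ ξ' : Fin (N + 1) → K} {c c' : K}

theorem IsBetheRoot.ne_zero (h : IsBetheRoot k ξ c) (i : Fin (N + 1)) : ξ i ≠ 0 :=
  Finset.prod_ne_zero_iff.1 (h.prod_eq_one ▸ one_ne_zero) i (Finset.mem_univ i)

theorem isCoprime_one_sub_C_mul_X {a b : K} (hab : a ≠ b) :
    IsCoprime (1 - Polynomial.C a * Polynomial.X) (1 - Polynomial.C b * Polynomial.X) := by
  refine ⟨Polynomial.C (-b / (a - b)), Polynomial.C (a / (a - b)), ?_⟩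
  have hconst : -b / (a - b) + a / (a - b) = 1 := by
    field_simp [sub_ne_zero.2 hab]
    ring
  have hlin : -b / (a - b) * a + a / (a - b) * b = 0 := by ring
  have hconst' := congrArg Polynomial.C hconst
  have hlin' := congrArg Polynomial.C hlin
  simp only [map_add, map_mul, map_one, map_zero] at hconst' hlin'
  linear_combination hconst' - Polynomial.X * hlin'

theorem IsBetheRoot.prodOneSub_dvd (h : IsBetheRoot k ξ c) :
    prodOneSub ξ ∣ 1 - Polynomial.C c * Polynomial.X ^ (N + 1 + k) := by
  refine Finset.prod_dvd_of_coprime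
    (fun i _ j _ hij => isCoprime_one_sub_C_mul_X (h.injective.ne hij)) fun i _ => ?_
  rw [← h.pow_eq i, Polynomial.C_pow, ← mul_pow]
  exact one_sub_dvd_one_sub_pow _ _

theorem coeff_prodOneSub_eq_neg_one_pow (hξ : ∏ i, ξ i = 1) :
    (prodOneSub ξ).coeff (N + 1) = (-1) ^ (N + 1) := by
  simpa [hξ] using coeff_card_prodOneSub ξ

theorem natDegree_prodOneSub (hξ : ∏ i, ξ i = 1) : (prodOneSub ξ).natDegree = N + 1 := by
  refine Polynomial.natDegree_eq_of_le_of_coeff_ne_zero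
    (by simpa using natDegree_prodOneSub_le ξ) ?_
  rw [coeff_prodOneSub_eq_neg_one_pow hξ]
  exact pow_ne_zero _ (neg_ne_zero.2 one_ne_zero)

theorem coeff_eq_coeff_of_mul_eq {R : Type*} [CommRing R] {P Q : R[X]} {F : R⟦X⟧} {c : R}
    {L r : ℕ} (hF : F * (Q : R⟦X⟧) = 1)
    (hPQ : P * Q = 1 - Polynomial.C c * Polynomial.X ^ L) (hr : r < L) :
    PowerSeries.coeff r F = P.coeff r := by
  have hPF : (P : R⟦X⟧) = F - PowerSeries.C c * F * PowerSeries.X ^ L := by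
    have hcoe := congrArg ((↑) : R[X] → R⟦X⟧) hPQ
    push_cast at hcoe
    linear_combination F * hcoe - (P : R⟦X⟧) * hF
  rw [← Polynomial.coeff_coe, hPF, map_sub, PowerSeries.coeff_mul_X_pow', if_neg hr.not_ge,
    sub_zero]

theorem coeff_hsymmSeries_eq_coeff {Q : K[X]} {L r : ℕ}
    (hQ : prodOneSub ξ * Q = 1 - Polynomial.C c * Polynomial.X ^ L) (hr : r < L) :
    PowerSeries.coeff r (hsymmSeries ξ) = Q.coeff r :=
  coeff_eq_coeff_of_mul_eq (by rw [mul_comm, prodOneSub_mul_hsymmSeries])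
    (by rw [mul_comm, hQ]) hr

theorem IsBetheRoot.prodOneSub_mul_elemPoly (h : IsBetheRoot k ξ c) :
    prodOneSub ξ * elemPoly (betheCoord k ξ) =
      1 - Polynomial.C c * Polynomial.X ^ (N + 1 + k) := by
  obtain ⟨Q, hQ⟩ := h.prodOneSub_dvd
  have hdeg : Q.natDegree ≤ k := by
    have hQ0 : Q ≠ 0 := by
      rintro rfl
      simpa using congrArg (Polynomial.eval 0) hQ
    have hP0 : prodOneSub ξ ≠ 0 := fun h0 => by simpa [h0] using coeff_zero_prodOneSub ξ
    have hmul := congrArg Polynomial.natDegree hQ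
    have hle : (1 - Polynomial.C c * Polynomial.X ^ (N + 1 + k)).natDegree ≤ N + 1 + k := by
      compute_degree
    rw [Polynomial.natDegree_mul hP0 hQ0, natDegree_prodOneSub h.prod_eq_one] at hmul
    omega
  have hQ0 : Q.coeff 0 = 1 := by
    rw [← coeff_hsymmSeries_eq_coeff hQ.symm (by omega), coeff_zero_hsymmSeries]
  have hcoord : betheCoord k ξ = fun i : Fin k => Q.coeff ((i : ℕ) + 1) :=
    funext fun i => coeff_hsymmSeries_eq_coeff hQ.symm (by omega)
  rw [hcoord, elemPoly_coeff_succ hdeg hQ0, hQ]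

theorem IsBetheRoot.coeff_hsymmSeries (h : IsBetheRoot k ξ c) {r : ℕ} (hr : r < N + 1 + k) :
    PowerSeries.coeff r (hsymmSeries ξ) = (elemPoly (betheCoord k ξ)).coeff r :=
  coeff_hsymmSeries_eq_coeff h.prodOneSub_mul_elemPoly hr

theorem IsBetheRoot.eq_neg_one_pow_mul_coeff (h : IsBetheRoot k ξ c) :
    c = (-1) ^ N * (elemPoly (betheCoord k ξ)).coeff k := by
  have htop := congrArg (Polynomial.coeff · (N + 1 + k)) h.prodOneSub_mul_elemPoly
  simp only [Polynomial.coeff_mul_add_eq_of_natDegree_le (natDegree_prodOneSub h.prod_eq_one).le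
    (natDegree_elemPoly_le _), coeff_prodOneSub_eq_neg_one_pow h.prod_eq_one,
    Polynomial.coeff_sub, Polynomial.coeff_one, Polynomial.coeff_C_mul_X_pow] at htop
  rw [if_neg (by omega), if_pos trivial, pow_succ] at htop
  linear_combination htop

theorem IsBetheRoot.prodOneSub_eq_of_betheCoord_eq (h : IsBetheRoot k ξ c)
    (h' : IsBetheRoot k ξ' c') (hcoord : betheCoord k ξ = betheCoord k ξ') :
    prodOneSub ξ = prodOneSub ξ' := by
  have hc : c = c' := by
    rw [h.eq_neg_one_pow_mul_coeff, h'.eq_neg_one_pow_mul_coeff, hcoord]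
  have hne : elemPoly (betheCoord k ξ') ≠ 0 := fun h0 => by
    simpa [h0] using coeff_zero_elemPoly (betheCoord k ξ')
  refine mul_right_cancel₀ hne ?_
  rw [← hcoord, h.prodOneSub_mul_elemPoly, hcoord, h'.prodOneSub_mul_elemPoly, hc]

theorem IsBetheRoot.range_eq_of_betheCoord_eq (h : IsBetheRoot k ξ c) (h' : IsBetheRoot k ξ' c')
    (hcoord : betheCoord k ξ = betheCoord k ξ') : Set.range ξ = Set.range ξ' := by
  have hroot {ξ : Fin (N + 1) → K} {c : K} (h : IsBetheRoot k ξ c) :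
      Set.range ξ = {a | a ≠ 0 ∧ (prodOneSub ξ).eval a⁻¹ = 0} := by
    ext a
    simp only [Set.mem_range, Set.mem_ofPred_eq, prodOneSub, Polynomial.eval_prod,
      Finset.prod_eq_zero_iff, Finset.mem_univ, true_and, Polynomial.eval_sub, Polynomial.eval_one,
      Polynomial.eval_mul, Polynomial.eval_C, Polynomial.eval_X]
    constructor
    · rintro ⟨i, rfl⟩
      exact ⟨h.ne_zero i, i, by rw [mul_inv_cancel₀ (h.ne_zero i), sub_self]⟩
    · rintro ⟨ha, i, hi⟩
      exact ⟨i, (mul_inv_eq_one₀ ha).1 (sub_eq_zero.1 hi).symm⟩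
  rw [hroot h, hroot h', h.prodOneSub_eq_of_betheCoord_eq h' hcoord]

end BetheRoot

/-! ### The Bethe functionals -/

section Pieri

variable {K : Type*} [Field K] {N k : ℕ} {ξ : Fin (N + 1) → K} {c : K}

theorem IsBetheRoot.prodOneSub_mul_det_pieriMatrix_expo (h : IsBetheRoot k ξ c)
    {m : Fin (N + 1) → ℕ} (hm : ∑ i, m i = k) :
    prodOneSub ξ * (pieriMatrix ξ (expo m) fun j => m (j - 1)).det =
      Polynomial.C (alternant ξ (expo m)) *
        (1 - Polynomial.C c * Polynomial.X ^ (N + 1 + k)) := by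
  have hquasi (i j) : ξ i ^ (expo m (j + 1) + m (j + 1 - 1) + 1) =
      (if j = Fin.last N then c else 1) * ξ i ^ expo m j := by
    rw [add_sub_cancel_right]
    cases j using Fin.lastCases with
    | last =>
      rw [Fin.last_add_one, expo_zero_add, hm, if_pos rfl, expo_last, pow_zero, mul_one,
        ← h.pow_eq i, add_assoc, add_comm]
    | cast j =>
      rw [Fin.coeSucc_eq_succ, expo_castSucc, if_neg j.castSucc_lt_last.ne, one_mul]
      congr 1
      omega
  have hshift : ∑ j, m (j - 1) = ∑ j, m j := Equiv.sum_comp (Equiv.subRight 1) m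
  rw [prodOneSub_mul_det_pieriMatrix hquasi, Finset.prod_ite_eq' Finset.univ,
    if_pos (Finset.mem_univ _), Finset.sum_add_distrib, hshift, hm, Finset.sum_const,
    Finset.card_univ, Fintype.card_fin, smul_eq_mul, mul_one, add_comm k]

theorem IsBetheRoot.sum_alternant_inflow (h : IsBetheRoot k ξ c) {m : Fin (N + 1) → ℕ}
    (hm : ∑ i, m i = k) {r : ℕ} (hr : r < N + 1 + k) :
    ∑ ε ∈ Finset.piAntidiag Finset.univ r with ∀ i, ε (i + 1) ≤ m i,
        alternant ξ (expo (inflow m ε)) =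
      PowerSeries.coeff r (hsymmSeries ξ) * alternant ξ (expo m) := by
  have hdet : (prodOneSub ξ : K⟦X⟧) *
      ((pieriMatrix ξ (expo m) fun j => m (j - 1)).det : K⟦X⟧) =
      PowerSeries.C (alternant ξ (expo m)) *
        (1 - PowerSeries.C c * PowerSeries.X ^ (N + 1 + k)) := by
    rw [← Polynomial.coe_mul, h.prodOneSub_mul_det_pieriMatrix_expo hm]
    simp
  rw [mul_comm, ← coeff_eq_mul_coeff_hsymmSeries hdet hr, Polynomial.coeff_coe,
    coeff_det_pieriMatrix]
  have hbound (ε : Fin (N + 1) → ℕ) : (∀ j, ε j ≤ m (j - 1)) ↔ ∀ i, ε (i + 1) ≤ m i := by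
    rw [(Equiv.addRight (1 : Fin (N + 1))).surjective.forall]
    simp only [Equiv.coe_addRight, add_sub_cancel_right]
  simp only [hbound]
  refine Finset.sum_congr rfl fun ε hε => ?_
  rw [← funext (expo_inflow (Finset.mem_filter.1 hε).2), alternant_add_const, h.prod_eq_one,
    one_pow, one_mul]

end Pieri

section Functional

variable {N k : ℕ} {ξ : Fin (N + 1) → ℂ} {c : ℂ}

/-- The linear functional `m ↦ det (ξ_i ^ expo m j)` on states. It is the pairing with the Bethe
vector of `ξ`, hence an eigenvector of the transposes of the plactic operators when `ξ` solves the
Bethe equations. -/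
def betheFunctional (ξ : Fin (N + 1) → ℂ) : State N →ₗ[ℂ] ℂ :=
  Finsupp.linearCombination ℂ fun m => alternant ξ (expo m)

theorem betheFunctional_single (ξ : Fin (N + 1) → ℂ) (m : Fin (N + 1) → ℕ) :
    betheFunctional ξ (Finsupp.single m 1) = alternant ξ (expo m) := by
  rw [betheFunctional, Finsupp.linearCombination_single, one_smul]

/-- The operator `T` preserves level `k` and acts on the left of `betheFunctional ξ`, restricted to
that level, as the scalar `a`. -/
structure ActsBy (k : ℕ) (ξ : Fin (N + 1) → ℂ) (T : Module.End ℂ (State N)) (a : ℂ) : Prop where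
  mem_level : ∀ x ∈ level N k, T x ∈ level N k
  functional_apply : ∀ x ∈ level N k, betheFunctional ξ (T x) = a * betheFunctional ξ x

theorem ActsBy.one : ActsBy k ξ 1 1 :=
  ⟨fun _ hx => hx, fun _ _ => (one_mul _).symm⟩

theorem ActsBy.mul {S T : Module.End ℂ (State N)} {a b : ℂ} (hS : ActsBy k ξ S a)
    (hT : ActsBy k ξ T b) : ActsBy k ξ (S * T) (a * b) where
  mem_level x hx := hS.mem_level _ (hT.mem_level x hx)
  functional_apply x hx := by
    rw [Module.End.mul_apply, hS.functional_apply _ (hT.mem_level x hx),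
      hT.functional_apply x hx, mul_assoc]

theorem ActsBy.smul {T : Module.End ℂ (State N)} {a : ℂ} (b : ℂ) (hT : ActsBy k ξ T a) :
    ActsBy k ξ (b • T) (b * a) where
  mem_level x hx := Submodule.smul_mem _ _ (hT.mem_level x hx)
  functional_apply x hx := by
    rw [LinearMap.smul_apply, map_smul, hT.functional_apply x hx, smul_eq_mul, mul_assoc]

theorem ActsBy.sum {ι : Type*} {s : Finset ι} {T : ι → Module.End ℂ (State N)} {a : ι → ℂ}
    (hT : ∀ i ∈ s, ActsBy k ξ (T i) (a i)) : ActsBy k ξ (∑ i ∈ s, T i) (∑ i ∈ s, a i) where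
  mem_level x hx := by
    rw [LinearMap.sum_apply]
    exact Submodule.sum_mem _ fun i hi => (hT i hi).mem_level x hx
  functional_apply x hx := by
    rw [LinearMap.sum_apply, map_sum, Finset.sum_mul]
    exact Finset.sum_congr rfl fun i hi => (hT i hi).functional_apply x hx

theorem ActsBy.prod_ofFn {M : ℕ} {T : Fin M → Module.End ℂ (State N)} {a : Fin M → ℂ}
    (hT : ∀ i, ActsBy k ξ (T i) (a i)) : ActsBy k ξ (List.ofFn T).prod (∏ i, a i) := by
  induction M with
  | zero => simpa using ActsBy.one
  | succ M ih =>
    rw [List.ofFn_succ, List.prod_cons, Fin.prod_univ_succ]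
    exact (hT 0).mul (ih fun i => hT i.succ)

theorem IsBetheRoot.actsBy_placticH (h : IsBetheRoot k ξ c) {r : ℕ} (hr : r < N + 1 + k) :
    ActsBy k ξ (placticH N r) (PowerSeries.coeff r (hsymmSeries ξ)) where
  mem_level x hx := by
    rw [level_eq_levelInt] at hx ⊢
    simpa using shifts_placticH N r _ x hx
  functional_apply x hx := by
    rw [level, Finsupp.supported_eq_span_single] at hx
    induction hx using Submodule.span_induction with
    | mem x hx =>
      obtain ⟨m, hm, rfl⟩ := hx
      simp only [placticH_single, map_sum, betheFunctional_single, h.sum_alternant_inflow hm hr]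
    | zero => simp
    | add x y _ _ hx hy => simp only [map_add, hx, hy, mul_add]
    | smul a x _ hx => simp only [map_smul, hx, smul_eq_mul, mul_left_comm]

theorem IsBetheRoot.actsBy_placticHInt (h : IsBetheRoot k ξ c) {r : ℤ} (hr : r < N + 1 + k) :
    ActsBy k ξ (placticHInt N r) (intCoeff (hsymmSeries ξ) r) := by
  rcases lt_or_ge r 0 with hneg | hnonneg
  · rw [placticHInt, if_neg hneg.not_ge, intCoeff_of_neg _ hneg]
    simpa using (ActsBy.one (ξ := ξ)).smul 0
  · lift r to ℕ using hnonneg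
    rw [intCoeff_natCast]
    simpa [placticHInt] using h.actsBy_placticH (by omega)

/-- The value `s_λ(ξ) = det (h_{λ_i - i + j}(ξ))` of a Schur polynomial. -/
def schurValue (ξ : Fin (N + 1) → ℂ) (lam : BoxPartition N k) : ℂ :=
  (jacobiTrudi (hsymmSeries ξ) fun i => ((lam.1 i : ℕ) : ℤ)).det

theorem IsBetheRoot.actsBy_placticSchur (h : IsBetheRoot k ξ c) (lam : BoxPartition N k) :
    ActsBy k ξ (placticSchur lam) (schurValue ξ lam) := by
  rw [schurValue, det_jacobiTrudi_eq_sum, placticSchur]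
  refine ActsBy.sum fun w _ => .smul _ <| .prod_ofFn fun i => h.actsBy_placticHInt ?_
  have := (lam.1 i).2
  have := (w i).2
  omega

theorem part_antitone (lam : BoxPartition N k) : Antitone (part lam) := by
  intro i j hij
  unfold part
  split_ifs with hj hi
  · exact lam.2 (show (⟨i, hi⟩ : Fin N) ≤ ⟨j, hj⟩ from hij)
  · omega
  · exact Nat.zero_le _
  · exact le_rfl

theorem part_le (lam : BoxPartition N k) (i : ℕ) : part lam i ≤ k := by
  unfold part
  split_ifs
  · exact Nat.lt_succ_iff.1 (lam.1 _).2
  · exact Nat.zero_le _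

theorem part_val (lam : BoxPartition N k) (i : Fin N) : part lam i = lam.1 i :=
  dif_pos i.2

theorem part_of_le (lam : BoxPartition N k) {i : ℕ} (hi : N ≤ i) : part lam i = 0 :=
  dif_neg hi.not_gt

theorem tailSum_dynkin (lam : BoxPartition N k) (j : Fin (N + 1)) :
    tailSum (dynkin lam) j = part lam j := by
  induction j using Fin.reverseInduction with
  | last => rw [tailSum_last, Fin.val_last, part_of_le lam le_rfl]
  | cast j ih =>
    have hle := part_antitone lam (Nat.le_add_right (j : ℕ) 1)
    rw [tailSum_castSucc, ih, dynkin, if_neg j.castSucc_lt_last.ne, Fin.val_succ, Fin.val_castSucc]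
    omega

theorem alternant_expo_dynkin (ξ : Fin (N + 1) → ℂ) (lam : BoxPartition N k) :
    alternant ξ (expo (dynkin lam)) = schurValue ξ lam * alternant ξ fun j => N - j := by
  rw [schurValue, ← alternant_snoc_zero_add_rho]
  congr 1
  ext j
  rw [expo, tailSum_dynkin]
  cases j using Fin.lastCases with
  | last => rw [Fin.snoc_last, Fin.val_last, part_of_le lam le_rfl]
  | cast j => rw [Fin.snoc_castSucc, Fin.val_castSucc, part_val]

end Functional

/-! ### The Bethe roots of a box partition -/

section BethePoint

variable {N k : ℕ}

theorem sum_half_sub_val (N : ℕ) : ∑ i : Fin (N + 1), ((N : ℝ) / 2 - (i : ℕ)) = 0 := by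
  have hgauss := congrArg (Nat.cast : ℕ → ℝ) (Finset.sum_range_id_mul_two (N + 1))
  rw [Nat.add_sub_cancel] at hgauss
  push_cast at hgauss
  rw [Finset.sum_sub_distrib, Fin.sum_univ_eq_sum_range (fun i => (i : ℝ)) (N + 1),
    Finset.sum_const, Finset.card_univ, Fintype.card_fin, nsmul_eq_mul]
  push_cast
  linarith

theorem sum_shiftedWeight (lam : BoxPartition N k) : ∑ i, shiftedWeight lam i = 0 := by
  have hpart : ∑ i : Fin (N + 1), (part lam i : ℝ) = ∑ j : Fin N, ((lam.1 j : ℕ) : ℝ) := by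
    simp only [Fin.sum_univ_castSucc, Fin.val_castSucc, part_val, Fin.val_last,
      part_of_le lam le_rfl, Nat.cast_zero, add_zero]
  unfold shiftedWeight
  rw [Finset.sum_add_distrib, sum_half_sub_val, Finset.sum_sub_distrib, hpart, Finset.sum_const,
    Finset.card_univ, Fintype.card_fin, nsmul_eq_mul]
  push_cast
  field_simp
  ring

/-- The difference between the coordinates of the shifted weight and the integers `λ_i - i`. -/
def weightOffset (lam : BoxPartition N k) : ℝ :=
  (N : ℝ) / 2 - (∑ j : Fin N, ((lam.1 j : ℕ) : ℝ)) / ((N : ℝ) + 1)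

theorem shiftedWeight_eq (lam : BoxPartition N k) (i : Fin (N + 1)) :
    shiftedWeight lam i = (((part lam i : ℤ) - (i : ℕ) : ℤ) : ℝ) + weightOffset lam := by
  rw [shiftedWeight, weightOffset]
  push_cast
  ring

theorem strictAnti_shiftedWeight (lam : BoxPartition N k) : StrictAnti (shiftedWeight lam) := by
  intro i j hij
  rw [shiftedWeight_eq, shiftedWeight_eq, add_lt_add_iff_right, Int.cast_lt]
  have := part_antitone lam hij.le
  rw [Fin.lt_def] at hij
  omega

theorem shiftedWeight_sub_lt (lam : BoxPartition N k) (i j : Fin (N + 1)) :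
    shiftedWeight lam i - shiftedWeight lam j < ((N + 1 + k : ℕ) : ℝ) := by
  rw [shiftedWeight_eq, shiftedWeight_eq, add_sub_add_right_eq_sub, ← Int.cast_sub,
    ← Int.cast_natCast (N + 1 + k), Int.cast_lt]
  have := part_le lam i
  omega

theorem shiftedWeight_injective :
    Function.Injective (shiftedWeight : BoxPartition N k → Fin (N + 1) → ℝ) := by
  intro sig tau hw
  have hoffset : weightOffset sig = weightOffset tau := by
    simpa [shiftedWeight_eq, part_of_le] using congrFun hw (Fin.last N)
  refine Subtype.ext (funext fun i => Fin.ext ?_)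
  simpa [shiftedWeight_eq, hoffset, part_val] using congrFun hw i.castSucc

/-- The Bethe root `ξ_i = exp (-2πi (σ + ρ)_i / (k + n))` attached to a partition `σ`. -/
def bethePoint (sig : BoxPartition N k) (i : Fin (N + 1)) : ℂ :=
  Complex.exp (-(2 * Real.pi * Complex.I / ((k : ℂ) + (N : ℂ) + 1)) * (shiftedWeight sig i : ℝ))

theorem exp_neg_two_pi_I_div_mul_eq_iff {L a b : ℂ} (hL : L ≠ 0) :
    Complex.exp (-(2 * Real.pi * Complex.I / L) * a) =
        Complex.exp (-(2 * Real.pi * Complex.I / L) * b) ↔ ∃ z : ℤ, a = b + L * z := by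
  rw [Complex.exp_eq_exp_iff_exists_int, (Equiv.neg ℤ).surjective.exists]
  refine exists_congr fun z => ?_
  have hshift : -(2 * Real.pi * Complex.I / L) * b +
      ((Equiv.neg ℤ z : ℤ) : ℂ) * (2 * Real.pi * Complex.I) =
        -(2 * Real.pi * Complex.I / L) * (b + L * z) := by
    rw [Equiv.neg_apply]
    push_cast
    field_simp
    ring
  rw [hshift, mul_right_inj' (neg_ne_zero.2 (div_ne_zero Complex.two_pi_I_ne_zero hL))]

theorem bethePoint_eq_iff {sig tau : BoxPartition N k} {i j : Fin (N + 1)} :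
    bethePoint sig i = bethePoint tau j ↔ ∃ z : ℤ,
      shiftedWeight sig i = shiftedWeight tau j + ((N + 1 + k : ℕ) : ℝ) * z := by
  have hL : (k : ℂ) + N + 1 ≠ 0 := by exact_mod_cast (by omega : k + N + 1 ≠ 0)
  rw [bethePoint, bethePoint, exp_neg_two_pi_I_div_mul_eq_iff hL]
  refine exists_congr fun z => ?_
  rw [← Complex.ofReal_inj]
  push_cast
  ring_nf

theorem eq_zero_of_natCast_mul_lt {L : ℕ} (hL : 0 < L) {z : ℤ} (hlt : (L : ℝ) * z < L)
    (hgt : -(L : ℝ) < L * z) : z = 0 := by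
  have hlt' : (L : ℤ) * z < L * 1 := by exact_mod_cast hlt.trans_eq (mul_one _).symm
  have hgt' : (L : ℤ) * (-1) < L * z := by
    have : ((L * (-1) : ℤ) : ℝ) < ((L * z : ℤ) : ℝ) := by push_cast; linarith
    exact_mod_cast this
  have := lt_of_mul_lt_mul_left hlt' (by positivity)
  have := lt_of_mul_lt_mul_left hgt' (by positivity)
  omega

theorem bethePoint_injective (sig : BoxPartition N k) : Function.Injective (bethePoint sig) := by
  intro i j hij
  obtain ⟨z, hz⟩ := bethePoint_eq_iff.1 hij
  have hij' := shiftedWeight_sub_lt sig i j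
  have hji' := shiftedWeight_sub_lt sig j i
  have hz0 : z = 0 := eq_zero_of_natCast_mul_lt (L := N + 1 + k) (by omega)
    (by linarith) (by linarith)
  exact (strictAnti_shiftedWeight sig).injective (by simpa [hz0] using hz)

theorem isBetheRoot_bethePoint (sig : BoxPartition N k) :
    IsBetheRoot k (bethePoint sig)
      (Complex.exp (-(2 * Real.pi * Complex.I * (weightOffset sig : ℝ)))) where
  injective := bethePoint_injective sig
  prod_eq_one := by
    simp only [bethePoint, ← Complex.exp_sum, ← Finset.mul_sum, ← Complex.ofReal_sum,
      sum_shiftedWeight, Complex.ofReal_zero, mul_zero, Complex.exp_zero]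
  pow_eq i := by
    have hL : (k : ℂ) + N + 1 ≠ 0 := by exact_mod_cast (by omega : k + N + 1 ≠ 0)
    rw [bethePoint, ← Complex.exp_nat_mul, Complex.exp_eq_exp_iff_exists_int]
    refine ⟨-((part sig i : ℤ) - (i : ℕ)), ?_⟩
    rw [shiftedWeight_eq]
    push_cast
    field_simp
    ring

theorem eq_zero_of_sum_eq_zero_of_sub_lt_two {ι : Type*} [Fintype ι] {z : ι → ℤ}
    (hsum : ∑ i, z i = 0) (hz : ∀ i j, z i - z j < 2) (i : ι) : z i = 0 := by
  by_contra hi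
  rcases lt_or_gt_of_ne hi with hneg | hpos
  · exact hi <| (Finset.sum_eq_zero_iff_of_nonpos fun j _ => by linarith [hz j i]).1 hsum i
      (Finset.mem_univ i)
  · exact hi <| (Finset.sum_eq_zero_iff_of_nonneg fun j _ => by linarith [hz i j]).1 hsum i
      (Finset.mem_univ i)

theorem range_shiftedWeight_eq_of_range_bethePoint_eq {sig tau : BoxPartition N k}
    (h : Set.range (bethePoint sig) = Set.range (bethePoint tau)) :
    Set.range (shiftedWeight sig) = Set.range (shiftedWeight tau) := by
  choose p hp using fun i => h ▸ Set.mem_range_self (f := bethePoint sig) i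
  choose z hz using fun i => bethePoint_eq_iff.1 (hp i).symm
  have hL : (0 : ℝ) < ((N + 1 + k : ℕ) : ℝ) := by positivity
  have hbij : Function.Bijective p := Finite.injective_iff_bijective.1 fun i j hij =>
    bethePoint_injective sig (by rw [← hp i, ← hp j, hij])
  have hsum : ∑ i, z i = 0 := by
    have hshift := Fintype.sum_congr _ _ hz
    rw [Finset.sum_add_distrib, hbij.sum_comp (shiftedWeight tau), sum_shiftedWeight,
      sum_shiftedWeight, ← Finset.mul_sum, zero_add] at hshift
    exact_mod_cast (mul_eq_zero.1 hshift.symm).resolve_left hL.ne'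
  have hdiff (i j) : z i - z j < 2 := by
    have hsig := shiftedWeight_sub_lt sig i j
    have htau := shiftedWeight_sub_lt tau (p j) (p i)
    rw [hz i, hz j] at hsig
    have hlt : ((N + 1 + k : ℕ) : ℝ) * ((z i : ℝ) - z j) < ((N + 1 + k : ℕ) : ℝ) * 2 := by
      linarith
    exact_mod_cast lt_of_mul_lt_mul_left hlt hL.le
  have hw : shiftedWeight sig = shiftedWeight tau ∘ p := funext fun i => by
    rw [hz i, eq_zero_of_sum_eq_zero_of_sub_lt_two hsum hdiff i, Int.cast_zero, mul_zero, add_zero,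
      Function.comp_apply]
  rw [hw, hbij.surjective.range_comp]

theorem eq_of_range_bethePoint_eq {sig tau : BoxPartition N k}
    (h : Set.range (bethePoint sig) = Set.range (bethePoint tau)) : sig = tau := by
  refine shiftedWeight_injective (neg_injective ?_)
  refine (StrictMono.range_inj (strictAnti_shiftedWeight sig).neg
    (strictAnti_shiftedWeight tau).neg).1 ?_
  have hneg (w : Fin (N + 1) → ℝ) : Set.range (-w) = Neg.neg '' Set.range w :=
    Set.range_comp Neg.neg w
  exact (hneg _).trans <| (congrArg _ (range_shiftedWeight_eq_of_range_bethePoint_eq h)).trans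
    (hneg _).symm

theorem betheCoord_bethePoint_injective :
    Function.Injective fun sig : BoxPartition N k => betheCoord k (bethePoint sig) :=
  fun sig tau h => eq_of_range_bethePoint_eq <|
    (isBetheRoot_bethePoint sig).range_eq_of_betheCoord_eq (isBetheRoot_bethePoint tau) h

end BethePoint

/-! ### Completeness of the Bethe ansatz -/

section Dual

theorem linearIndependent_of_dual_eigenvectors {ι α K V : Type*} [Field K] [AddCommMonoid V]
    [Module K V] {T : α → Module.End K V} {χ : ι → α → K} (hχ : Function.Injective χ)
    {f : ι → Module.Dual K V} (hf : ∀ i, f i ≠ 0)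
    (hT : ∀ i a x, f i (T a x) = χ i a * f i x) : LinearIndependent K f := by
  have hword (i : ι) (w : FreeMonoid α) (x : V) :
      f i (FreeMonoid.lift T w x) = FreeMonoid.lift (χ i) w * f i x := by
    induction w using FreeMonoid.inductionOn' generalizing x with
    | one => simp
    | of_mul a w ih => simp only [map_mul, FreeMonoid.lift_eval_of, Module.End.mul_apply, hT, ih,
        mul_assoc]
  -- Dedekind: the characters of the free monoid on `α` defined by the `χ i` are independent.
  have hind : LinearIndependent K fun i => (FreeMonoid.lift (χ i) : FreeMonoid α → K) :=
    (linearIndependent_monoidHom (FreeMonoid α) K).comp _ (FreeMonoid.lift.injective.comp hχ)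
  rw [linearIndependent_iff'] at hind ⊢
  intro s g hg i hi
  obtain ⟨x, hx⟩ := DFunLike.ne_iff.1 (hf i)
  refine (mul_eq_zero.1 (hind s (fun i => g i * f i x) ?_ i hi)).resolve_right hx
  ext w
  have := DFunLike.congr_fun hg (FreeMonoid.lift T w x)
  simpa only [LinearMap.sum_apply, LinearMap.smul_apply, hword, smul_eq_mul, LinearMap.zero_apply,
    Finset.sum_apply, Pi.smul_apply, Pi.zero_apply, mul_assoc, mul_comm (f _ x)] using this

variable {ι κ K V : Type*} [Field K] [AddCommMonoid V] [Module K V]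

theorem card_le_of_linearIndependent_dual [Fintype ι] [Fintype κ] (b : Module.Basis ι K V)
    {f : κ → Module.Dual K V} (hf : LinearIndependent K f) : Fintype.card κ ≤ Fintype.card ι := by
  have := (hf.map' _ (b.constr K).symm.ker).fintype_card_le_finrank
  rwa [Module.finrank_fintype_fun_eq_card] at this

theorem isUnit_of_linearIndependent_dual [Fintype ι] [DecidableEq ι] (b : Module.Basis ι K V)
    {f : ι → Module.Dual K V} (hf : LinearIndependent K f) :
    IsUnit (Matrix.of fun i j => f i (b j)) :=
  Matrix.linearIndependent_rows_iff_isUnit.1 (hf.map' _ (b.constr K).symm.ker)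

theorem bijective_pi_of_linearIndependent_dual [Finite ι] (b : Module.Basis ι K V)
    {f : ι → Module.Dual K V} (hf : LinearIndependent K f) :
    Function.Bijective (LinearMap.pi f) := by
  classical
  cases nonempty_fintype ι
  have hA := isUnit_of_linearIndependent_dual b hf
  have heq : ⇑(LinearMap.pi f) = (Matrix.of fun i j => f i (b j)).mulVec ∘ b.equivFun := by
    ext x i
    calc f i x = f i (∑ j, b.equivFun x j • b j) := by rw [b.sum_equivFun]
      _ = _ := by simp [Matrix.mulVec, dotProduct, mul_comm, -Module.Basis.sum_repr]
  rw [heq]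
  exact .comp ⟨Matrix.mulVec_injective_of_isUnit hA, Matrix.mulVec_surjective_iff_isUnit.2 hA⟩
    b.equivFun.bijective

end Dual

section Completeness

variable {N k : ℕ} {ξ : Fin (N + 1) → ℂ} {c : ℂ}

theorem dynkin_injective : Function.Injective (dynkin : BoxPartition N k → Fin (N + 1) → ℕ) := by
  intro lam mu h
  refine Subtype.ext (funext fun i => Fin.ext ?_)
  rw [← part_val, ← part_val, ← Fin.val_castSucc, ← tailSum_dynkin, h, tailSum_dynkin]

theorem exists_dynkin_eq {m : Fin (N + 1) → ℕ} (hm : ∑ i, m i = k) :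
    ∃ lam : BoxPartition N k, dynkin lam = m := by
  have hzero : tailSum m 0 + m (Fin.last N) = k := (tailSum_zero_add m).trans hm
  have hlt (j) : tailSum m j < k + 1 := by
    have := tailSum_antitone m (Fin.zero_le j)
    omega
  let lam : BoxPartition N k := ⟨fun i => ⟨tailSum m i.castSucc, hlt _⟩,
    (tailSum_antitone m).comp_monotone Fin.strictMono_castSucc.monotone⟩
  have hpart (j : Fin (N + 1)) : part lam j = tailSum m j := by
    cases j using Fin.lastCases with
    | last => rw [Fin.val_last, part_of_le lam le_rfl, tailSum_last]
    | cast j => exact part_val lam j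
  refine ⟨lam, funext fun i => ?_⟩
  cases i using Fin.lastCases with
  | last =>
    rw [dynkin, if_pos rfl, ← Fin.val_zero (N + 1), hpart]
    omega
  | cast i =>
    have hi : part lam i.castSucc = tailSum m i.castSucc := hpart i.castSucc
    have hsucc : part lam (i.castSucc + 1) = tailSum m i.succ := hpart i.succ
    rw [dynkin, if_neg i.castSucc_lt_last.ne, hi, hsucc, tailSum_castSucc, Nat.add_sub_cancel]

/-- The bijection `dynkin` between partitions and affine weights of level `k`. -/
def dynkinEquiv (N k : ℕ) : BoxPartition N k ≃ {m : Fin (N + 1) → ℕ | ∑ i, m i = k} :=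
  .ofBijective (fun lam => ⟨dynkin lam, sum_dynkin lam⟩)
    ⟨fun _ _ h => dynkin_injective (congrArg Subtype.val h), fun m =>
      (exists_dynkin_eq m.2).imp fun _ h => Subtype.ext h⟩

/-- The affine weights of level `k`, indexed by partitions, as a basis of `ℂP⁺ₖ`. -/
def weightBasis (N k : ℕ) : Module.Basis (BoxPartition N k) ℂ (level N k) :=
  .ofRepr <| Finsupp.supportedEquivFinsupp {m : Fin (N + 1) → ℕ | ∑ i, m i = k} ≪≫ₗ
    Finsupp.domLCongr (dynkinEquiv N k).symm

theorem weightBasis_apply (lam : BoxPartition N k) : weightBasis N k lam = weightVec lam := by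
  classical
  refine Subtype.ext ?_
  calc (weightBasis N k lam : State N)
      = (Finsupp.supportedEquivFinsupp {m : Fin (N + 1) → ℕ | ∑ i, m i = k}).symm
          (Finsupp.domLCongr (R := ℂ) (dynkinEquiv N k) (Finsupp.single lam (1 : ℂ))) := rfl
    _ = Finsupp.single (dynkin lam) 1 := by
      rw [Finsupp.domLCongr_single, Finsupp.supportedEquivFinsupp_symm_single]
      rfl

/-- The restriction of `betheFunctional ξ` to `ℂP⁺ₖ`. -/
def betheDual (k : ℕ) (ξ : Fin (N + 1) → ℂ) : Module.Dual ℂ (level N k) :=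
  (betheFunctional ξ).domRestrict (level N k)

theorem betheDual_weightVec (ξ : Fin (N + 1) → ℂ) (lam : BoxPartition N k) :
    betheDual k ξ (weightVec lam) = schurValue ξ lam * alternant ξ fun j => N - j :=
  (betheFunctional_single ξ _).trans (alternant_expo_dynkin ξ lam)

theorem schurValue_emptyPartition (ξ : Fin (N + 1) → ℂ) :
    schurValue ξ (emptyPartition N k) = 1 :=
  det_jacobiTrudi_zero (coeff_zero_hsymmSeries ξ)

theorem IsBetheRoot.betheDual_ne_zero (h : IsBetheRoot k ξ c) : betheDual k ξ ≠ 0 := by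
  refine DFunLike.ne_iff.2 ⟨weightVec (emptyPartition N k), ?_⟩
  rw [betheDual_weightVec, schurValue_emptyPartition, one_mul]
  exact alternant_rho_ne_zero h.injective

theorem IsBetheRoot.betheDual_placticSchurLevel (h : IsBetheRoot k ξ c) (lam : BoxPartition N k)
    (x : level N k) :
    betheDual k ξ (placticSchurLevel lam x) = schurValue ξ lam * betheDual k ξ x :=
  (h.actsBy_placticSchur lam).functional_apply x x.2

theorem linearIndependent_betheDual {ι : Type*} {ξ : ι → Fin (N + 1) → ℂ}
    (hξ : ∀ i, ∃ c, IsBetheRoot k (ξ i) c)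
    (hinj : Function.Injective fun i => betheCoord k (ξ i)) :
    LinearIndependent ℂ fun i => betheDual k (ξ i) := by
  have hlevel (r : ℕ) (x : State N) (hx : x ∈ level N k) : placticH N r x ∈ level N k := by
    rw [level_eq_levelInt] at hx ⊢
    simpa using shifts_placticH N r _ x hx
  choose c hc using hξ
  refine linearIndependent_of_dual_eigenvectors (χ := fun i => betheCoord k (ξ i))
    (T := fun r : Fin k => (placticH N (r + 1)).restrict (hlevel (r + 1))) hinj
    (fun i => (hc i).betheDual_ne_zero) fun i r x => ?_
  exact ((hc i).actsBy_placticH (by omega)).functional_apply x x.2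

theorem IsBetheRoot.exists_betheCoord_eq (h : IsBetheRoot k ξ c) :
    ∃ sig : BoxPartition N k, betheCoord k (bethePoint sig) = betheCoord k ξ := by
  by_contra hne
  have hind : LinearIndependent ℂ fun i : Option (BoxPartition N k) =>
      betheDual k (i.elim ξ bethePoint) := by
    refine linearIndependent_betheDual
      (Option.forall.2 ⟨⟨c, h⟩, fun sig => ⟨_, isBetheRoot_bethePoint sig⟩⟩) ?_
    exact Option.injective_iff.2 ⟨betheCoord_bethePoint_injective, hne⟩
  have hcard := card_le_of_linearIndependent_dual (weightBasis N k) hind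
  rw [Fintype.card_option] at hcard
  omega

theorem linearIndependent_betheDual_bethePoint (N k : ℕ) :
    LinearIndependent ℂ fun sig : BoxPartition N k => betheDual k (bethePoint sig) :=
  linearIndependent_betheDual (fun sig => ⟨_, isBetheRoot_bethePoint sig⟩)
    betheCoord_bethePoint_injective

/-- The coordinates of a state of level `k` given by the Bethe functionals: the change of basis
which diagonalises the operators `s_λ(a)_k` simultaneously. -/
def betheTransform (N k : ℕ) : level N k ≃ₗ[ℂ] (BoxPartition N k → ℂ) :=
  .ofBijective (LinearMap.pi fun sig => betheDual k (bethePoint sig))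
    (bijective_pi_of_linearIndependent_dual (weightBasis N k)
      (linearIndependent_betheDual_bethePoint N k))

end Completeness

/-! ### The modular S-matrix and the Verlinde formula -/

section Verlinde

variable {N k : ℕ}

/-- The normalisation of the modular `S`-matrix. -/
def modularPrefactor (N k : ℕ) : ℂ :=
  Complex.exp (Complex.I * Real.pi * ((N : ℂ) + 1) * (N : ℂ) / 4) /
    (Real.sqrt (((N : ℝ) + 1) * ((k : ℝ) + (N : ℝ) + 1) ^ N) : ℂ)

theorem modularPrefactor_ne_zero (N k : ℕ) : modularPrefactor N k ≠ 0 :=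
  div_ne_zero (Complex.exp_ne_zero _) (Complex.ofReal_ne_zero.2 (by positivity))

theorem sum_shiftedWeight_mul_shiftedWeight (sig lam : BoxPartition N k)
    (w : Equiv.Perm (Fin (N + 1))) :
    ∑ i, shiftedWeight sig i * shiftedWeight lam (w i) =
      ∑ i, shiftedWeight sig i * expo (dynkin lam) (w i) := by
  have hexpo (j : Fin (N + 1)) :
      shiftedWeight lam j = expo (dynkin lam) j + (weightOffset lam - N) := by
    rw [shiftedWeight_eq, expo, tailSum_dynkin]
    push_cast [Nat.cast_sub (Fin.is_le j)]
    ring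
  simp only [hexpo, mul_add, Finset.sum_add_distrib]
  rw [← Finset.sum_mul, sum_shiftedWeight, zero_mul, add_zero]

theorem modularS_apply (lam sig : BoxPartition N k) :
    modularS N k lam sig =
      modularPrefactor N k * alternant (bethePoint sig) (expo (dynkin lam)) := by
  rw [alternant, Matrix.det_apply', modularS, Matrix.of_apply, modularPrefactor]
  congr 1
  refine Finset.sum_congr rfl fun w _ => congrArg _ ?_
  rw [sum_shiftedWeight_mul_shiftedWeight, Complex.ofReal_sum, Finset.mul_sum, Complex.exp_sum,
    ← Equiv.prod_comp w]
  refine Finset.prod_congr rfl fun i _ => ?_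
  rw [← Equiv.Perm.mul_apply, inv_mul_cancel, Equiv.Perm.one_apply, Matrix.of_apply, bethePoint,
    ← Complex.exp_nat_mul]
  congr 1
  push_cast
  ring

theorem isUnit_modularS (N k : ℕ) : IsUnit (modularS N k) := by
  have hA := isUnit_of_linearIndependent_dual (weightBasis N k)
    (linearIndependent_betheDual_bethePoint N k)
  have heq : modularS N k = modularPrefactor N k • (Matrix.of fun i j =>
      betheDual k (bethePoint i) (weightBasis N k j)).transpose := by
    ext lam sig
    rw [modularS_apply, Matrix.smul_apply, Matrix.transpose_apply, Matrix.of_apply,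
      weightBasis_apply, betheDual_weightVec, alternant_expo_dynkin, smul_eq_mul]
  rw [heq, ← (modularPrefactor_ne_zero N k).isUnit.unit_spec, ← Units.smul_def,
    isUnit_smul_iff]
  exact Matrix.isUnit_transpose _ |>.2 hA

theorem modularS_transpose (N k : ℕ) : (modularS N k).transpose = modularS N k := by
  ext lam sig
  rw [Matrix.transpose_apply, modularS, Matrix.of_apply, Matrix.of_apply,
    ← Equiv.sum_comp (Equiv.inv (Equiv.Perm (Fin (N + 1))))]
  congr 1
  refine Finset.sum_congr rfl fun w _ => ?_
  have hsum : ∑ i, shiftedWeight lam i * shiftedWeight sig (w i) =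
      ∑ i, shiftedWeight sig i * shiftedWeight lam (w⁻¹ i) := by
    rw [← Equiv.sum_comp w⁻¹]
    refine Finset.sum_congr rfl fun i _ => ?_
    rw [← Equiv.Perm.mul_apply, mul_inv_cancel, Equiv.Perm.one_apply, mul_comm]
  rw [Equiv.inv_apply, Equiv.Perm.sign_inv, inv_inv, hsum]

theorem modularS_eq_schurValue_mul (lam sig : BoxPartition N k) :
    modularS N k lam sig =
      schurValue (bethePoint sig) lam * modularS N k (emptyPartition N k) sig := by
  simp only [modularS_apply, alternant_expo_dynkin, schurValue_emptyPartition, one_mul]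
  exact mul_left_comm _ _ _

theorem modularS_emptyPartition_ne_zero (sig : BoxPartition N k) :
    modularS N k (emptyPartition N k) sig ≠ 0 := by
  rw [modularS_apply, alternant_expo_dynkin, schurValue_emptyPartition, one_mul]
  exact mul_ne_zero (modularPrefactor_ne_zero N k)
    (alternant_rho_ne_zero (bethePoint_injective sig))

theorem sum_modularS_inv_mul_modularS (sig tau : BoxPartition N k) :
    ∑ nu, (modularS N k)⁻¹ nu tau * modularS N k nu sig = if tau = sig then 1 else 0 := by
  have hsymm (nu) : (modularS N k)⁻¹ nu tau = (modularS N k)⁻¹ tau nu := by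
    rw [← Matrix.transpose_apply (modularS N k)⁻¹, Matrix.transpose_nonsing_inv, modularS_transpose]
  simp only [hsymm]
  rw [← Matrix.mul_apply, Matrix.nonsing_inv_mul _ ((Matrix.isUnit_iff_isUnit_det _).1
    (isUnit_modularS N k)), Matrix.one_apply]

theorem sum_fusionCoeff_mul_modularS (lam mu sig : BoxPartition N k) :
    ∑ nu, fusionCoeff lam mu nu * modularS N k nu sig =
      modularS N k lam sig * modularS N k mu sig / modularS N k (emptyPartition N k) sig := by
  calc ∑ nu, fusionCoeff lam mu nu * modularS N k nu sig
      = ∑ tau, modularS N k lam tau * modularS N k mu tau / modularS N k (emptyPartition N k) tau *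
          ∑ nu, (modularS N k)⁻¹ nu tau * modularS N k nu sig := by
        simp only [fusionCoeff, Finset.sum_mul, Finset.mul_sum]
        rw [Finset.sum_comm]
        exact Finset.sum_congr rfl fun tau _ => Finset.sum_congr rfl fun nu _ => by ring
    _ = _ := by simp [sum_modularS_inv_mul_modularS]

theorem sum_fusionCoeff_mul_schurValue (lam mu sig : BoxPartition N k) :
    ∑ nu, fusionCoeff lam mu nu * schurValue (bethePoint sig) nu =
      schurValue (bethePoint sig) lam * schurValue (bethePoint sig) mu := by
  have hne := modularS_emptyPartition_ne_zero sig
  apply mul_right_cancel₀ hne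
  rw [mul_assoc, ← modularS_eq_schurValue_mul, Finset.sum_mul]
  simp only [mul_assoc, ← modularS_eq_schurValue_mul]
  rw [sum_fusionCoeff_mul_modularS, modularS_eq_schurValue_mul lam, mul_right_comm,
    mul_div_cancel_right₀ _ hne]

end Verlinde

section Spectrum

variable {N k : ℕ}

/-- The values of the Schur polynomial `s_λ` at the Bethe roots, that is the spectrum of the
operator `s_λ(a)_k`. -/
def schurSpectrum (lam : BoxPartition N k) : BoxPartition N k → ℂ :=
  fun sig => schurValue (bethePoint sig) lam

theorem schurSpectrum_mul (lam mu : BoxPartition N k) :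
    schurSpectrum lam * schurSpectrum mu = ∑ nu, fusionCoeff lam mu nu • schurSpectrum nu := by
  ext sig
  simpa only [Finset.sum_apply, Pi.mul_apply, Pi.smul_apply, smul_eq_mul, schurSpectrum]
    using (sum_fusionCoeff_mul_schurValue lam mu sig).symm

theorem betheTransform_placticSchurLevel (lam : BoxPartition N k) (x : level N k) :
    betheTransform N k (placticSchurLevel lam x) = schurSpectrum lam * betheTransform N k x :=
  funext fun sig => (isBetheRoot_bethePoint sig).betheDual_placticSchurLevel lam x

theorem betheTransform_weightVec (lam : BoxPartition N k) :
    betheTransform N k (weightVec lam) =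
      schurSpectrum lam * fun sig => alternant (bethePoint sig) fun j => N - j :=
  funext fun sig => betheDual_weightVec (bethePoint sig) lam

theorem placticSchurLevel_weightVec (lam mu : BoxPartition N k) :
    placticSchurLevel lam (weightVec mu) = ∑ nu, fusionCoeff lam mu nu • weightVec nu := by
  apply (betheTransform N k).injective
  simp only [betheTransform_placticSchurLevel, betheTransform_weightVec, map_sum, map_smul,
    ← mul_assoc, schurSpectrum_mul, Finset.sum_mul, smul_mul_assoc]

/-- The embedding of the functions on the Bethe roots as the operators which are diagonal in the
coordinates of the Bethe transform. -/
def betheDiagonal (N k : ℕ) : (BoxPartition N k → ℂ) →ₐ[ℂ] Module.End ℂ (level N k) :=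
  ((betheTransform N k).symm.conjAlgEquiv ℂ : _ →ₐ[ℂ] _).comp (Algebra.lmul ℂ _)

theorem betheDiagonal_injective (N k : ℕ) : Function.Injective (betheDiagonal N k) :=
  ((betheTransform N k).symm.conjAlgEquiv ℂ).injective.comp Algebra.lmul_injective

theorem betheDiagonal_schurSpectrum (lam : BoxPartition N k) :
    betheDiagonal N k (schurSpectrum lam) = placticSchurLevel lam := by
  ext1 x
  exact (betheTransform N k).symm_apply_eq.2 (betheTransform_placticSchurLevel lam x).symm

theorem placticSchurLevel_mul (lam mu : BoxPartition N k) :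
    placticSchurLevel lam * placticSchurLevel mu =
      ∑ nu, fusionCoeff lam mu nu • placticSchurLevel nu := by
  simp only [← betheDiagonal_schurSpectrum, ← map_mul, schurSpectrum_mul, map_sum, map_smul]

end Spectrum

/-! ### The Bethe variety -/

section Converse

variable {K : Type*} [Field K] {n N k : ℕ}

theorem exists_prodOneSub_eq {P : K[X]} (hP : P.Splits) (hdeg : P.natDegree = n)
    (h0 : P.coeff 0 = 1) : ∃ ξ : Fin n → K, prodOneSub ξ = P := by
  classical
  have hP0 : P ≠ 0 := fun h => by simp [h] at h0
  let e : Fin n ≃ P.roots.ToType := (Fintype.equivFinOfCardEq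
    (by rw [Multiset.card_coe, ← hP.natDegree_eq_card_roots, hdeg])).symm
  refine ⟨fun i => ((e i).1)⁻¹, ?_⟩
  have hfactor (a : K) (ha : a ∈ P.roots) : (1 - Polynomial.C a⁻¹ * Polynomial.X : K[X]) =
      Polynomial.C (-a⁻¹) * (Polynomial.X - Polynomial.C a) := by
    have ha0 : a ≠ 0 := by
      rintro rfl
      rw [Polynomial.mem_roots hP0, Polynomial.IsRoot.def,
        ← Polynomial.coeff_zero_eq_eval_zero, h0] at ha
      exact one_ne_zero ha
    rw [mul_sub, ← Polynomial.C_mul, neg_mul, inv_mul_cancel₀ ha0, Polynomial.C_neg,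
      Polynomial.C_neg, Polynomial.C_1]
    ring
  have hprod : prodOneSub (fun i => ((e i).1)⁻¹) =
      (P.roots.map fun a => 1 - Polynomial.C a⁻¹ * Polynomial.X).prod := by
    rw [prodOneSub, e.prod_comp fun a : P.roots.ToType => 1 - Polynomial.C a.1⁻¹ * Polynomial.X,
      Finset.prod_eq_multiset_prod]
    exact congrArg _ (Multiset.map_univ _ fun a : K => 1 - Polynomial.C a⁻¹ * Polynomial.X)
  have hassoc : Polynomial.C P.leadingCoeff * prodOneSub (fun i => ((e i).1)⁻¹) =
      Polynomial.C (P.roots.map fun a => -a⁻¹).prod * P := by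
    rw [hprod, Multiset.map_congr rfl hfactor, Multiset.prod_map_mul,
      Multiset.prod_hom' _ Polynomial.C]
    linear_combination (-Polynomial.C (P.roots.map fun a => -a⁻¹).prod) * hP.eq_prod_roots
  have hlead := congrArg (Polynomial.coeff · 0) hassoc
  simp only [Polynomial.coeff_C_mul, coeff_zero_prodOneSub, h0, mul_one] at hlead
  rw [← hlead] at hassoc
  exact mul_left_cancel₀ (Polynomial.C_ne_zero.2 (Polynomial.leadingCoeff_ne_zero.2 hP0)) hassoc

theorem separable_one_sub_C_mul_X_pow (c : K) {L : ℕ} (hL : (L : K) ≠ 0) :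
    (1 - Polynomial.C c * Polynomial.X ^ L : K[X]).Separable := by
  refine ⟨1, Polynomial.C (L : K)⁻¹ * -Polynomial.X, ?_⟩
  have hC : (Polynomial.C (L : K)⁻¹ * Polynomial.C (L : K) : K[X]) = 1 := by
    rw [← Polynomial.C_mul, inv_mul_cancel₀ hL, Polynomial.C_1]
  obtain ⟨L, rfl⟩ := Nat.exists_eq_succ_of_ne_zero (fun h : L = 0 => hL (by simp [h]))
  rw [Polynomial.derivative_sub, Polynomial.derivative_one, Polynomial.derivative_C_mul_X_pow,
    Nat.succ_sub_one, pow_succ, Polynomial.C_mul]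
  linear_combination (Polynomial.C c * (Polynomial.X * Polynomial.X ^ L)) * hC

theorem isBetheRoot_of_prodOneSub_dvd {ξ : Fin (N + 1) → K} {c : K}
    (hL : ((N + 1 + k : ℕ) : K) ≠ 0) (hξ : ∏ i, ξ i = 1)
    (hdvd : prodOneSub ξ ∣ 1 - Polynomial.C c * Polynomial.X ^ (N + 1 + k)) :
    IsBetheRoot k ξ c := by
  have hne (i) : ξ i ≠ 0 := Finset.prod_ne_zero_iff.1 (hξ ▸ one_ne_zero) i (Finset.mem_univ i)
  refine ⟨fun i j hij => ?_, hξ, fun i => ?_⟩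
  · by_contra hne'
    have hsq : (1 - Polynomial.C (ξ i) * Polynomial.X) * (1 - Polynomial.C (ξ i) * Polynomial.X) ∣
        prodOneSub ξ := by
      nth_rw 2 [hij]
      rw [prodOneSub, ← Finset.prod_pair (f := fun i => 1 - Polynomial.C (ξ i) * Polynomial.X) hne']
      exact Finset.prod_dvd_prod_of_subset _ _ _ (Finset.subset_univ _)
    have hunit := (separable_one_sub_C_mul_X_pow c hL).squarefree _ (hsq.trans hdvd)
    have hroot := (hunit.map (Polynomial.evalRingHom (ξ i)⁻¹)).ne_zero
    simp [hne i] at hroot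
  · have hroot := Polynomial.eval_dvd (x := (ξ i)⁻¹) hdvd
    rw [prodOneSub, Polynomial.eval_prod, Finset.prod_eq_zero (Finset.mem_univ i) (by simp [hne i]),
      zero_dvd_iff] at hroot
    simp only [Polynomial.eval_sub, Polynomial.eval_one, Polynomial.eval_mul, Polynomial.eval_C,
      Polynomial.eval_pow, Polynomial.eval_X, inv_pow] at hroot
    exact (mul_inv_eq_one₀ (pow_ne_zero _ (hne i))).1 (sub_eq_zero.1 hroot).symm |>.symm

theorem mul_eq_one_sub_C_mul_X_pow {R : Type*} [CommRing R] {P Q : R[X]} {F : R⟦X⟧} {L : ℕ}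
    (hL : 0 < L) (hdeg : (P * Q).natDegree ≤ L) (hF : F * Q = 1)
    (hPF : ∀ r < L, P.coeff r = PowerSeries.coeff r F) :
    P * Q = 1 - Polynomial.C (-(P * Q).coeff L) * Polynomial.X ^ L := by
  ext r
  rw [Polynomial.coeff_sub, Polynomial.coeff_C_mul_X_pow]
  rcases lt_trichotomy r L with hr | rfl | hr
  · rw [if_neg hr.ne, sub_zero, ← Polynomial.coeff_coe (1 : R[X]), Polynomial.coe_one, ← hF,
      PowerSeries.coeff_mul, Polynomial.coeff_mul]
    refine Finset.sum_congr rfl fun p hp => ?_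
    rw [hPF _ ((Finset.HasAntidiagonal.antidiagonal.fst_le hp).trans_lt hr), Polynomial.coeff_coe]
  · rw [if_pos rfl, Polynomial.coeff_one, if_neg hL.ne', zero_sub, neg_neg]
  · rw [if_neg hr.ne', sub_zero, Polynomial.coeff_one, if_neg (by omega),
      Polynomial.coeff_eq_zero_of_natDegree_lt (hdeg.trans_lt hr)]

theorem elemPoly_inv_mul_cancel (x : Fin k → K) :
    (elemPoly x : K⟦X⟧)⁻¹ * (elemPoly x : K⟦X⟧) = 1 := by
  refine PowerSeries.inv_mul_cancel _ ?_
  rw [Polynomial.constantCoeff_coe, coeff_zero_elemPoly]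
  exact one_ne_zero

theorem exists_isBetheRoot_of_coeff [IsAlgClosed K] (hL : ((N + 1 + k : ℕ) : K) ≠ 0)
    {x : Fin k → K} {F : K⟦X⟧} (hF : F * (elemPoly x : K⟦X⟧) = 1)
    (htop : PowerSeries.coeff (N + 1) F = (-1) ^ (N + 1))
    (hzero : ∀ r, N + 1 < r → r < N + 1 + k → PowerSeries.coeff r F = 0) :
    ∃ (ξ : Fin (N + 1) → K) (c : K), IsBetheRoot k ξ c ∧ betheCoord k ξ = x := by
  let P := PowerSeries.trunc (N + 2) F
  have hPcoeff {r : ℕ} (hr : r < N + 2) : P.coeff r = PowerSeries.coeff r F := by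
    rw [PowerSeries.coeff_trunc, if_pos hr]
  have hPF (r : ℕ) (hr : r < N + 1 + k) : P.coeff r = PowerSeries.coeff r F := by
    rcases lt_or_ge r (N + 2) with h | h
    · exact hPcoeff h
    · rw [PowerSeries.coeff_trunc, if_neg h.not_gt, hzero r (by omega) hr]
  have hPtop : P.coeff (N + 1) = (-1) ^ (N + 1) := by rw [hPcoeff (by omega), htop]
  have hPdeg : P.natDegree = N + 1 := Polynomial.natDegree_eq_of_le_of_coeff_ne_zero
    (Nat.lt_succ_iff.1 (PowerSeries.natDegree_trunc_lt F (N + 1)))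
    (hPtop ▸ pow_ne_zero _ (neg_ne_zero.2 one_ne_zero))
  have hP0 : P.coeff 0 = 1 := by
    have h := congrArg PowerSeries.constantCoeff hF
    rw [map_mul, ← PowerSeries.coeff_zero_eq_constantCoeff_apply (elemPoly x : K⟦X⟧),
      Polynomial.coeff_coe, coeff_zero_elemPoly, mul_one, map_one] at h
    rw [hPcoeff (by omega), PowerSeries.coeff_zero_eq_constantCoeff_apply, h]
  have hmul := mul_eq_one_sub_C_mul_X_pow (L := N + 1 + k) (by omega)
    (Polynomial.natDegree_mul_le_of_le hPdeg.le (natDegree_elemPoly_le x)) hF hPF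
  obtain ⟨ξ, hξ⟩ := exists_prodOneSub_eq (IsAlgClosed.splits P) hPdeg hP0
  rw [← hξ] at hmul
  have hprod : ∏ i, ξ i = 1 := by
    have h := coeff_card_prodOneSub ξ
    rw [hξ, Fintype.card_fin, hPtop] at h
    exact (mul_eq_left₀ (pow_ne_zero _ (neg_ne_zero.2 one_ne_zero))).1 h.symm
  refine ⟨ξ, _, isBetheRoot_of_prodOneSub_dvd hL hprod ⟨_, hmul.symm⟩, funext fun i => ?_⟩
  rw [betheCoord, coeff_hsymmSeries_eq_coeff hmul (by omega), coeff_succ_elemPoly]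

end Converse

section BetheVariety

variable {N k : ℕ}

theorem aeval_eVar (x : Fin k → ℂ) (r : ℤ) :
    MvPolynomial.aeval x (eVar k r) = intCoeff (elemPoly x : ℂ⟦X⟧) r := by
  rcases lt_or_ge r 0 with hr | hr
  · rw [intCoeff_of_neg _ hr, eVar, if_neg (by omega), dif_neg (by omega), map_zero]
  lift r to ℕ using hr
  rw [intCoeff_natCast, Polynomial.coeff_coe, eVar]
  rcases r with - | r
  · rw [Nat.cast_zero, if_pos rfl, map_one, coeff_zero_elemPoly]
  rw [if_neg (by omega)]
  split_ifs with hr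
  · have hindex : (((r + 1 : ℕ) : ℤ) - 1).toNat = r := by omega
    rw [MvPolynomial.aeval_X]
    simp only [hindex]
    exact (coeff_succ_elemPoly x ⟨r, by omega⟩).symm
  · rw [map_zero, Polynomial.coeff_eq_zero_of_natDegree_lt
      ((natDegree_elemPoly_le x).trans_lt (by omega))]

theorem aeval_hPoly (x : Fin k → ℂ) {F : ℂ⟦X⟧} (hF : F * (elemPoly x : ℂ⟦X⟧) = 1) (r : ℕ) :
    MvPolynomial.aeval x (hPoly k r) = (-1) ^ r * PowerSeries.coeff r F := by
  have h0 : PowerSeries.coeff 0 (elemPoly x : ℂ⟦X⟧) = 1 := by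
    rw [Polynomial.coeff_coe, coeff_zero_elemPoly]
  rw [← det_jacobiTrudi_one (mul_comm F _ ▸ hF) h0, hPoly, AlgHom.map_det]
  congr 1
  ext i j
  exact aeval_eVar x _

theorem mem_betheVariety_iff {n : ℕ} {x : Fin k → ℂ} {F : ℂ⟦X⟧}
    (hF : F * (elemPoly x : ℂ⟦X⟧) = 1) :
    x ∈ betheVariety n k ↔
      ∀ i < k, PowerSeries.coeff (n + i) F = if i = 0 then (-1) ^ n else 0 := by
  have hneg (r : ℕ) : (-1 : ℂ) ^ r ≠ 0 := pow_ne_zero _ (neg_ne_zero.2 one_ne_zero)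
  rw [betheVariety, MvPolynomial.zeroLocus_span, Set.mem_ofPred_eq, Set.forall_mem_range,
    Fin.forall_iff]
  refine forall₂_congr fun i hi => ?_
  rw [map_sub, aeval_hPoly x hF, sub_eq_zero]
  split_ifs with h
  · subst h
    rw [map_one, add_zero, ← mul_right_inj' (hneg n), ← mul_assoc, ← mul_pow, neg_mul_neg, one_mul,
      one_pow, one_mul, mul_one]
  · rw [map_zero, mul_eq_zero_iff_left (hneg _)]

theorem IsBetheRoot.betheCoord_mem_betheVariety {ξ : Fin (N + 1) → ℂ} {c : ℂ}
    (h : IsBetheRoot k ξ c) : betheCoord k ξ ∈ betheVariety (N + 1) k := by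
  rw [mem_betheVariety_iff (elemPoly_inv_mul_cancel _)]
  intro i hi
  rw [coeff_eq_coeff_of_mul_eq (elemPoly_inv_mul_cancel _) h.prodOneSub_mul_elemPoly (by omega)]
  split_ifs with hi0
  · rw [hi0, add_zero, coeff_prodOneSub_eq_neg_one_pow h.prod_eq_one]
  · exact Polynomial.coeff_eq_zero_of_natDegree_lt
      (by rw [natDegree_prodOneSub h.prod_eq_one]; omega)

theorem betheVariety_eq_range (N k : ℕ) :
    betheVariety (N + 1) k =
      Set.range fun sig : BoxPartition N k => betheCoord k (bethePoint sig) := by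
  ext x
  constructor
  · intro hx
    rcases Nat.eq_zero_or_pos k with rfl | hk
    · exact ⟨emptyPartition N 0, Subsingleton.elim _ _⟩
    rw [mem_betheVariety_iff (elemPoly_inv_mul_cancel x)] at hx
    obtain ⟨ξ, c, hξ, rfl⟩ := exists_isBetheRoot_of_coeff (N := N)
      (Nat.cast_ne_zero.2 (by omega)) (elemPoly_inv_mul_cancel x) (hx 0 hk) fun r hr hr' => by
        obtain ⟨i, rfl⟩ := Nat.exists_eq_add_of_lt hr
        exact (hx (i + 1) (by omega)).trans (if_neg i.succ_ne_zero)
    exact hξ.exists_betheCoord_eq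
  · rintro ⟨sig, rfl⟩
    exact (isBetheRoot_bethePoint sig).betheCoord_mem_betheVariety

end BetheVariety

/-! ### The coordinate ring of the Bethe variety -/

section CoordinateRing

variable {N k : ℕ}

theorem span_range_schurSpectrum (N k : ℕ) :
    Submodule.span ℂ (Set.range (schurSpectrum (N := N) (k := k))) = ⊤ := by
  refine eq_top_iff.2 fun f _ => ?_
  set δ : BoxPartition N k → ℂ := fun sig => alternant (bethePoint sig) fun j => N - j with hδ
  have hδ' : IsUnit δ := Pi.isUnit_iff.2 fun sig =>
    (alternant_rho_ne_zero (bethePoint_injective sig)).isUnit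
  have hsum := congrArg (betheTransform N k)
    ((weightBasis N k).sum_repr ((betheTransform N k).symm (f * δ)))
  simp only [map_sum, map_smul, weightBasis_apply, betheTransform_weightVec,
    LinearEquiv.apply_symm_apply, ← hδ, ← smul_mul_assoc, ← Finset.sum_mul] at hsum
  rw [← hδ'.mul_right_cancel hsum]
  exact Submodule.sum_mem _ fun lam _ => Submodule.smul_mem _ _ (Submodule.subset_span ⟨lam, rfl⟩)

theorem adjoin_range_schurSpectrum (N k : ℕ) :
    Algebra.adjoin ℂ (Set.range (schurSpectrum (N := N) (k := k))) = ⊤ := by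
  rw [← Algebra.toSubmodule_eq_top, eq_top_iff, ← span_range_schurSpectrum]
  exact Algebra.span_le_adjoin _ _

theorem placticSchurAlgebra_eq_range (N k : ℕ) :
    placticSchurAlgebra N k = (betheDiagonal N k).range := by
  have himage : Set.range (placticSchurLevel (N := N) (k := k)) =
      betheDiagonal N k '' Set.range schurSpectrum := by
    rw [← Set.range_comp]
    exact congrArg Set.range (funext fun lam => (betheDiagonal_schurSpectrum lam).symm)
  rw [placticSchurAlgebra, himage, ← AlgHom.map_adjoin, adjoin_range_schurSpectrum,
    Algebra.map_top]

/-- The simultaneous diagonalisation of the algebra of affine plactic Schur polynomials: an operator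
is sent to its eigenvalues, as a function on the Bethe roots. -/
def spectrumEquiv (N k : ℕ) : placticSchurAlgebra N k ≃ₐ[ℂ] (BoxPartition N k → ℂ) :=
  (Subalgebra.equivOfEq _ _ (placticSchurAlgebra_eq_range N k)).trans
    (AlgEquiv.ofInjective _ (betheDiagonal_injective N k)).symm

theorem spectrumEquiv_placticSchurGen (lam : BoxPartition N k) :
    spectrumEquiv N k (placticSchurGen lam) = schurSpectrum lam :=
  (AlgEquiv.ofInjective _ (betheDiagonal_injective N k)).symm_apply_eq.2
    (Subtype.ext (betheDiagonal_schurSpectrum lam).symm)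

/-- Evaluation of polynomials at the points of the Bethe variety. -/
def betheEval (N k : ℕ) : MvPolynomial (Fin k) ℂ →ₐ[ℂ] (BoxPartition N k → ℂ) :=
  AlgHom.pi fun sig => MvPolynomial.aeval (betheCoord k (bethePoint sig))

theorem ker_betheEval (N k : ℕ) : RingHom.ker (betheEval N k) = betheIdeal (N + 1) k := by
  ext p
  rw [RingHom.mem_ker, betheIdeal, MvPolynomial.mem_vanishingIdeal_iff, betheVariety_eq_range,
    Set.forall_mem_range, funext_iff]
  rfl

theorem IsBetheRoot.schurValue_eq {ξ : Fin (N + 1) → ℂ} {c : ℂ} (h : IsBetheRoot k ξ c)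
    (lam : BoxPartition N k) :
    schurValue ξ lam = (jacobiTrudi (elemPoly (betheCoord k ξ) : ℂ⟦X⟧)
      fun i => ((lam.1 i : ℕ) : ℤ)).det := by
  rw [schurValue]
  congr 1
  ext i j
  rw [jacobiTrudi_apply, jacobiTrudi_apply]
  rcases lt_or_ge (((lam.1 i : ℕ) : ℤ) - (i : ℕ) + (j : ℕ)) 0 with hr | hr
  · rw [intCoeff_of_neg _ hr, intCoeff_of_neg _ hr]
  · generalize hr' : ((lam.1 i : ℕ) : ℤ) - (i : ℕ) + (j : ℕ) = r at hr ⊢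
    lift r to ℕ using hr
    rw [intCoeff_natCast, intCoeff_natCast, h.coeff_hsymmSeries (by omega), Polynomial.coeff_coe]

/-- The polynomial in `e₁, …, e_k` representing the Schur polynomial of the transpose of `λ`, given
by the dual Jacobi-Trudi formula. -/
def schurE (lam : BoxPartition N k) : MvPolynomial (Fin k) ℂ :=
  (jacobiTrudi (elemPoly MvPolynomial.X : (MvPolynomial (Fin k) ℂ)[X])
    fun i => ((lam.1 i : ℕ) : ℤ)).det

theorem betheEval_schurE (lam : BoxPartition N k) :
    betheEval N k (schurE lam) = schurSpectrum lam := by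
  ext sig
  let f : MvPolynomial (Fin k) ℂ →+* ℂ :=
    (MvPolynomial.aeval (R := ℂ) (betheCoord k (bethePoint sig))).toRingHom
  have hf : ⇑f ∘ MvPolynomial.X = betheCoord k (bethePoint sig) :=
    funext fun i => MvPolynomial.aeval_X _ i
  change f (schurE lam) = schurValue (bethePoint sig) lam
  rw [schurE, map_det_jacobiTrudi, map_elemPoly, hf, (isBetheRoot_bethePoint sig).schurValue_eq]

theorem betheEval_surjective (N k : ℕ) : Function.Surjective (betheEval N k) := by
  rw [← AlgHom.range_eq_top, eq_top_iff, ← adjoin_range_schurSpectrum, Algebra.adjoin_le_iff]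
  rintro _ ⟨lam, rfl⟩
  exact ⟨schurE lam, betheEval_schurE lam⟩

/-- The isomorphism of the algebra of affine plactic Schur polynomials with the coordinate ring of
the Bethe variety: both are the algebra of functions on the Bethe roots. -/
def placticSchurAlgebraEquiv (N k : ℕ) :
    placticSchurAlgebra N k ≃ₐ[ℂ] (MvPolynomial (Fin k) ℂ ⧸ betheIdeal (N + 1) k) :=
  (spectrumEquiv N k).trans
    ((Ideal.quotientEquivAlgOfEq ℂ (ker_betheEval N k).symm).trans
      (Ideal.quotientKerAlgEquivOfSurjective (betheEval_surjective N k))).symm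

theorem placticSchurAlgebraEquiv_placticSchurGen (lam : BoxPartition N k) :
    placticSchurAlgebraEquiv N k (placticSchurGen lam) =
      Ideal.Quotient.mk (betheIdeal (N + 1) k) (schurE lam) := by
  rw [placticSchurAlgebraEquiv, AlgEquiv.trans_apply, AlgEquiv.symm_apply_eq,
    spectrumEquiv_placticSchurGen]
  exact (betheEval_schurE lam).symm

end CoordinateRing

/-! ### The dual Jacobi-Trudi formula for semistandard tableaux -/

section HorizontalStrips

/-- The relation that `nu` arises from `mu` by removing the horizontal strip consisting of the
bottom cells of the columns in `S`. Both diagrams have at most `M` columns, so that `S` and the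
column lengths may be indexed by `Fin M`. -/
structure IsStripRemoval {M : ℕ} (mu nu : YoungDiagram) (S : Finset (Fin M)) : Prop where
  rowLen_left_le : mu.rowLen 0 ≤ M
  rowLen_right_le : nu.rowLen 0 ≤ M
  colLen_eq : ∀ i : Fin M, mu.colLen i = nu.colLen i + if i ∈ S then 1 else 0

theorem snd_lt_rowLen_zero {mu : YoungDiagram} {c : ℕ × ℕ} (hc : c ∈ mu) : c.2 < mu.rowLen 0 :=
  YoungDiagram.mem_iff_lt_rowLen.1 (mu.up_left_mem (Nat.zero_le c.1) le_rfl hc)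

theorem exists_colLen_eq {M : ℕ} {f : Fin M → ℕ} (hf : Antitone f) :
    ∃ nu : YoungDiagram, nu.rowLen 0 ≤ M ∧ ∀ i : Fin M, nu.colLen i = f i := by
  have hsorted : (List.ofFn f).SortedGE := hf.sortedGE_ofFn
  refine ⟨(YoungDiagram.ofRowLens _ hsorted).transpose, ?_, fun i => ?_⟩
  · by_contra! hM
    have hmem := YoungDiagram.mem_iff_lt_rowLen.2 hM
    obtain ⟨hlt, -⟩ := YoungDiagram.mem_ofRowLens.1 (YoungDiagram.mem_transpose.1 hmem)
    simp at hlt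
  · rw [YoungDiagram.colLen_transpose]
    exact (YoungDiagram.rowLen_ofRowLens (w := List.ofFn f) ⟨i, by simp⟩).trans (by simp)

variable {M : ℕ} {mu nu : YoungDiagram} {S : Finset (Fin M)}

theorem exists_isStripRemoval (hM : mu.rowLen 0 ≤ M)
    (hanti : Antitone (removeBoxes (fun i : Fin M => (mu.colLen i : ℤ)) S))
    (hpos : ∀ i, 0 ≤ removeBoxes (fun i : Fin M => (mu.colLen i : ℤ)) S i) :
    ∃ nu, IsStripRemoval mu nu S := by
  obtain ⟨nu, hnu, hcol⟩ := exists_colLen_eq fun i j hij => Int.toNat_le_toNat (hanti hij)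
  refine ⟨nu, hM, hnu, fun i => ?_⟩
  have hi := hpos i
  rw [hcol i]
  simp only [removeBoxes] at hi ⊢
  split_ifs at hi ⊢ <;> omega

namespace IsStripRemoval

theorem removeBoxes_eq (h : IsStripRemoval mu nu S) :
    removeBoxes (fun i : Fin M => (mu.colLen i : ℤ)) S = fun i : Fin M => (nu.colLen i : ℤ) :=
  funext fun i => by simp [removeBoxes, h.colLen_eq i]

theorem le (h : IsStripRemoval mu nu S) : nu ≤ mu := by
  rintro ⟨a, b⟩ hc
  have hb : b < M := (snd_lt_rowLen_zero hc).trans_le h.rowLen_right_le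
  have hcol := h.colLen_eq ⟨b, hb⟩
  exact YoungDiagram.mem_iff_lt_colLen.2
    ((YoungDiagram.mem_iff_lt_colLen.1 hc).trans_le (hcol ▸ Nat.le_add_right _ _))

theorem mk_notMem_iff (h : IsStripRemoval mu nu S) {a : ℕ} {i : Fin M} (hc : (a, (i : ℕ)) ∈ mu) :
    (a, (i : ℕ)) ∉ nu ↔ i ∈ S ∧ a + 1 = mu.colLen i := by
  have hcol := h.colLen_eq i
  rw [YoungDiagram.mem_iff_lt_colLen] at hc ⊢
  by_cases hi : i ∈ S
  · rw [if_pos hi] at hcol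
    simp only [hi, true_and]
    omega
  · rw [if_neg hi] at hcol
    simp only [hi, false_and, iff_false, not_not]
    omega

theorem mem_of_mem_of_fst_lt (h : IsStripRemoval mu nu S) {c d : ℕ × ℕ} (hd : d ∈ mu)
    (hcd : c.2 = d.2) (hlt : c.1 < d.1) : c ∈ nu := by
  obtain ⟨a, b⟩ := c
  obtain ⟨a', b'⟩ := d
  obtain rfl : b = b' := hcd
  have hb : b < M := (snd_lt_rowLen_zero hd).trans_le h.rowLen_left_le
  have hd' := YoungDiagram.mem_iff_lt_colLen.1 hd
  by_contra hc
  have hbot := ((h.mk_notMem_iff (i := ⟨b, hb⟩) (mu.up_left_mem hlt.le le_rfl hd)).1 hc).2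
  simp only at hbot hlt
  omega

theorem card_sdiff (h : IsStripRemoval mu nu S) : (mu.cells \ nu.cells).card = S.card := by
  symm
  refine Finset.card_bij (fun i _ => (nu.colLen i, (i : ℕ))) (fun i hi => ?_)
    (fun i _ j _ hij => Fin.ext (Prod.ext_iff.1 hij).2) fun c hc => ?_
  · have hcol := h.colLen_eq i
    rw [if_pos hi] at hcol
    rw [Finset.mem_sdiff, YoungDiagram.mem_cells, YoungDiagram.mem_cells,
      YoungDiagram.mem_iff_lt_colLen, YoungDiagram.mem_iff_lt_colLen]
    omega
  · obtain ⟨hmu, hnu⟩ := Finset.mem_sdiff.1 hc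
    obtain ⟨a, b⟩ := c
    have hb : b < M := (snd_lt_rowLen_zero hmu).trans_le h.rowLen_left_le
    obtain ⟨hS, hbot⟩ := (h.mk_notMem_iff (i := ⟨b, hb⟩) hmu).1 hnu
    have hcol := h.colLen_eq ⟨b, hb⟩
    rw [if_pos hS] at hcol
    exact ⟨⟨b, hb⟩, hS, Prod.ext (by simp only at hbot hcol ⊢; omega) rfl⟩

end IsStripRemoval

end HorizontalStrips

section Tableaux

variable {M l : ℕ} {mu nu : YoungDiagram} {S : Finset (Fin M)}

open scoped Classical in
/-- The columns of a tableau that contain the largest letter. -/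
def lastColumns (M : ℕ) (T : mu.cells → Fin (l + 1)) : Finset (Fin M) :=
  {i | ∃ c : mu.cells, c.1.2 = i ∧ T c = Fin.last l}

theorem mem_lastColumns {T : mu.cells → Fin (l + 1)} {i : Fin M} :
    i ∈ lastColumns M T ↔ ∃ c : mu.cells, c.1.2 = i ∧ T c = Fin.last l := by
  simp [lastColumns]

theorem IsSemistandard.fst_add_one_eq_colLen {T : mu.cells → Fin (l + 1)}
    (hT : IsSemistandard mu T) {c : mu.cells} (hc : T c = Fin.last l) :
    c.1.1 + 1 = mu.colLen c.1.2 := by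
  obtain ⟨⟨a, b⟩, hmem⟩ := c
  have hlt : a < mu.colLen b := YoungDiagram.mem_iff_lt_colLen.1 hmem
  by_contra hne
  have hbelow : (a + 1, b) ∈ mu.cells :=
    YoungDiagram.mem_iff_lt_colLen.2 (by simp only at hne; omega)
  exact (hT.2 ⟨(a, b), hmem⟩ ⟨_, hbelow⟩ rfl a.lt_succ_self).not_ge (hc ▸ Fin.le_last _)

theorem IsSemistandard.eq_last_iff {T : mu.cells → Fin (l + 1)} (hT : IsSemistandard mu T)
    {c : mu.cells} {i : Fin M} (hc : c.1.2 = i) :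
    T c = Fin.last l ↔ i ∈ lastColumns M T ∧ c.1.1 + 1 = mu.colLen i := by
  refine ⟨fun hl => ⟨mem_lastColumns.2 ⟨c, hc, hl⟩, hc ▸ hT.fst_add_one_eq_colLen hl⟩, ?_⟩
  rintro ⟨hi, hbot⟩
  obtain ⟨d, hd, hl⟩ := mem_lastColumns.1 hi
  have hbot' := hT.fst_add_one_eq_colLen hl
  rw [hd, ← hbot] at hbot'
  rwa [show c = d from Subtype.ext (Prod.ext (Nat.succ_injective hbot').symm (hc.trans hd.symm))]

theorem IsSemistandard.colLen_pos {T : mu.cells → Fin (l + 1)} (hT : IsSemistandard mu T)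
    {i : Fin M} (hi : i ∈ lastColumns M T) : 0 < mu.colLen i := by
  obtain ⟨c, hc, hl⟩ := mem_lastColumns.1 hi
  exact hc ▸ hT.fst_add_one_eq_colLen hl ▸ Nat.succ_pos _

theorem IsSemistandard.mem_lastColumns_of_colLen_eq {T : mu.cells → Fin (l + 1)}
    (hT : IsSemistandard mu T) {i j : Fin M} (hi : i ∈ lastColumns M T) (hij : i ≤ j)
    (hcol : mu.colLen i = mu.colLen j) : j ∈ lastColumns M T := by
  obtain rfl | hlt := hij.eq_or_lt
  · exact hi
  have hpos := hT.colLen_pos hi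
  have hci : (mu.colLen i - 1, (i : ℕ)) ∈ mu.cells :=
    YoungDiagram.mem_iff_lt_colLen.2 (by omega)
  have hcj : (mu.colLen i - 1, (j : ℕ)) ∈ mu.cells :=
    YoungDiagram.mem_iff_lt_colLen.2 (by omega)
  have hlast : T ⟨_, hci⟩ = Fin.last l :=
    (hT.eq_last_iff rfl).2 ⟨hi, by simp only; omega⟩
  have hle := hT.1 ⟨_, hci⟩ ⟨_, hcj⟩ rfl hlt
  exact mem_lastColumns.2 ⟨_, rfl, Fin.last_le_iff.1 (hlast ▸ hle)⟩

theorem IsSemistandard.exists_isStripRemoval {T : mu.cells → Fin (l + 1)}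
    (hT : IsSemistandard mu T) (hM : mu.rowLen 0 ≤ M) :
    ∃ nu, IsStripRemoval mu nu (lastColumns M T) := by
  refine PhaseModel.exists_isStripRemoval hM (fun i j hij => ?_) fun i => ?_
  · have hle := mu.colLen_anti i j hij
    have hmem := fun hi => hT.mem_lastColumns_of_colLen_eq (M := M) hi hij
    simp only [removeBoxes]
    split_ifs with hj hi hi
    · omega
    · omega
    · have hne : mu.colLen i ≠ mu.colLen j := fun he => hj (hmem hi he)
      omega
    · omega
  · have hpos := hT.colLen_pos (M := M) (i := i)
    simp only [removeBoxes]
    split_ifs with hi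
    · have := hpos hi
      omega
    · omega

theorem IsStripRemoval.lastColumns_eq_iff (h : IsStripRemoval mu nu S) {T : mu.cells → Fin (l + 1)}
    (hT : IsSemistandard mu T) :
    lastColumns M T = S ↔ ∀ c : mu.cells, c.1 ∈ nu ↔ T c ≠ Fin.last l := by
  constructor
  · rintro rfl ⟨⟨a, b⟩, hc⟩
    have hb : b < M := (snd_lt_rowLen_zero hc).trans_le h.rowLen_left_le
    rw [← not_iff_not, not_not, hT.eq_last_iff (i := ⟨b, hb⟩) rfl]
    exact h.mk_notMem_iff (i := ⟨b, hb⟩) hc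
  · intro hmem
    ext i
    rw [mem_lastColumns]
    constructor
    · rintro ⟨⟨⟨a, b⟩, hc⟩, rfl, hl⟩
      exact ((h.mk_notMem_iff hc).1 fun hnu => (hmem ⟨_, hc⟩).1 hnu hl).1
    · intro hi
      have hcol := h.colLen_eq i
      rw [if_pos hi] at hcol
      have hc : (nu.colLen i, (i : ℕ)) ∈ mu := YoungDiagram.mem_iff_lt_colLen.2 (by omega)
      exact ⟨⟨_, hc⟩, rfl, not_not.1 ((hmem ⟨_, hc⟩).not.1
        ((h.mk_notMem_iff hc).2 ⟨hi, hcol.symm⟩))⟩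

/-- The filling of a larger diagram that extends a filling of `nu` by a new largest letter. -/
def extendTableau (mu : YoungDiagram) (T : nu.cells → Fin l) (c : mu.cells) : Fin (l + 1) :=
  if h : c.1 ∈ nu.cells then (T ⟨c.1, h⟩).castSucc else Fin.last l

theorem extendTableau_of_mem {T : nu.cells → Fin l} {c : mu.cells} (h : c.1 ∈ nu.cells) :
    extendTableau mu T c = (T ⟨c.1, h⟩).castSucc :=
  dif_pos h

theorem extendTableau_mk (T : nu.cells → Fin l) (c : nu.cells) (h : c.1 ∈ mu.cells) :
    extendTableau mu T ⟨c.1, h⟩ = (T c).castSucc :=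
  dif_pos c.2

theorem extendTableau_of_notMem {T : nu.cells → Fin l} {c : mu.cells} (h : c.1 ∉ nu.cells) :
    extendTableau mu T c = Fin.last l :=
  dif_neg h

theorem mem_iff_extendTableau_ne_last {T : nu.cells → Fin l} {c : mu.cells} :
    c.1 ∈ nu ↔ extendTableau mu T c ≠ Fin.last l := by
  refine ⟨fun h => ?_, fun h => of_not_not fun hc => h (extendTableau_of_notMem hc)⟩
  rw [extendTableau_of_mem h]
  exact (Fin.castSucc_lt_last _).ne

theorem extendTableau_injective (hle : nu ≤ mu) :
    Function.Injective (extendTableau mu : (nu.cells → Fin l) → _) := by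
  intro T T' hTT'
  funext c
  have hc := congrFun hTT' ⟨c.1, hle c.2⟩
  rw [extendTableau_mk, extendTableau_mk] at hc
  exact Fin.castSucc_injective _ hc

theorem exists_extendTableau_eq (hle : nu ≤ mu) {T : mu.cells → Fin (l + 1)}
    (hT : ∀ c : mu.cells, c.1 ∈ nu ↔ T c ≠ Fin.last l) :
    ∃ T' : nu.cells → Fin l, extendTableau mu T' = T := by
  refine ⟨fun c => (T ⟨c.1, hle c.2⟩).castPred ((hT _).1 c.2), funext fun c => ?_⟩
  by_cases hc : c.1 ∈ nu.cells
  · rw [extendTableau_of_mem hc, Fin.castSucc_castPred]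
  · rw [extendTableau_of_notMem hc]
    exact (of_not_not fun hne => hc ((hT c).2 hne)).symm

theorem IsSemistandard.of_extendTableau (hle : nu ≤ mu) {T : nu.cells → Fin l}
    (hT : IsSemistandard mu (extendTableau mu T)) : IsSemistandard nu T := by
  refine ⟨fun c d hcd hlt => ?_, fun c d hcd hlt => ?_⟩
  · have h := hT.1 ⟨c.1, hle c.2⟩ ⟨d.1, hle d.2⟩ hcd hlt
    rw [extendTableau_mk, extendTableau_mk] at h
    exact Fin.castSucc_le_castSucc_iff.1 h
  · have h := hT.2 ⟨c.1, hle c.2⟩ ⟨d.1, hle d.2⟩ hcd hlt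
    rw [extendTableau_mk, extendTableau_mk] at h
    exact Fin.castSucc_lt_castSucc_iff.1 h

theorem IsSemistandard.extendTableau (h : IsStripRemoval mu nu S) {T : nu.cells → Fin l}
    (hT : IsSemistandard nu T) : IsSemistandard mu (extendTableau mu T) := by
  refine ⟨fun c d hcd hlt => ?_, fun c d hcd hlt => ?_⟩
  · by_cases hd : d.1 ∈ nu.cells
    · have hc : c.1 ∈ nu.cells := nu.up_left_mem hcd.le hlt.le hd
      rw [extendTableau_of_mem hc, extendTableau_of_mem hd]
      exact Fin.castSucc_le_castSucc_iff.2 (hT.1 ⟨c.1, hc⟩ ⟨d.1, hd⟩ hcd hlt)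
    · rw [extendTableau_of_notMem hd]
      exact Fin.le_last _
  · have hc : c.1 ∈ nu.cells := h.mem_of_mem_of_fst_lt d.2 hcd hlt
    rw [extendTableau_of_mem hc]
    by_cases hd : d.1 ∈ nu.cells
    · rw [extendTableau_of_mem hd]
      exact Fin.castSucc_lt_castSucc_iff.2 (hT.2 ⟨c.1, hc⟩ ⟨d.1, hd⟩ hcd hlt)
    · rw [extendTableau_of_notMem hd]
      exact Fin.castSucc_lt_last _

variable {A : Type*} [CommRing A]

theorem prod_extendTableau (x : Fin (l + 1) → A) (hle : nu ≤ mu) (T : nu.cells → Fin l) :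
    ∏ c, x (extendTableau mu T c) =
      x (Fin.last l) ^ (mu.cells \ nu.cells).card * ∏ c, x (T c).castSucc := by
  let y : ℕ × ℕ → A := fun c =>
    if h : c ∈ nu.cells then x (T ⟨c, h⟩).castSucc else x (Fin.last l)
  have hmu : ∏ c, x (extendTableau mu T c) = ∏ c ∈ mu.cells, y c := by
    rw [← Finset.prod_coe_sort mu.cells y]
    exact Finset.prod_congr rfl fun c _ => apply_dite x _ _ _
  have hnu : ∏ c, x (T c).castSucc = ∏ c ∈ nu.cells, y c := by
    rw [← Finset.prod_coe_sort nu.cells y]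
    exact Finset.prod_congr rfl fun c _ => by simp only [y, c.2, dif_pos]
  have hstrip : ∏ c ∈ mu.cells \ nu.cells, y c =
      x (Fin.last l) ^ (mu.cells \ nu.cells).card :=
    Finset.prod_eq_pow_card fun c hc => dif_neg (Finset.mem_sdiff.1 hc).2
  rw [hmu, hnu, ← hstrip, Finset.prod_sdiff (YoungDiagram.cells_subset_iff.2 hle)]

open scoped Classical in
/-- The Schur function of `mu` in the letters `x₀, …, x_{l-1}`, as the weighted sum of
semistandard tableaux. -/
def tableauSum (x : Fin l → A) (mu : YoungDiagram) : A :=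
  ∑ T : mu.cells → Fin l with IsSemistandard mu T, ∏ c, x (T c)

open scoped Classical in
theorem IsStripRemoval.sum_tableaux (h : IsStripRemoval mu nu S) (x : Fin (l + 1) → A) :
    ∑ T : mu.cells → Fin (l + 1) with IsSemistandard mu T ∧ lastColumns M T = S, ∏ c, x (T c) =
      x (Fin.last l) ^ S.card * tableauSum (fun i => x i.castSucc) nu := by
  rw [tableauSum, Finset.mul_sum]
  symm
  refine Finset.sum_bij (fun T _ => extendTableau mu T) (fun T hT => ?_)
    (fun T _ T' _ hTT' => extendTableau_injective h.le hTT') (fun T hT => ?_) fun T _ => ?_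
  · have hext := (Finset.mem_filter.1 hT).2.extendTableau h
    exact Finset.mem_filter.2 ⟨Finset.mem_univ _, hext,
      (h.lastColumns_eq_iff hext).2 fun c => mem_iff_extendTableau_ne_last⟩
  · obtain ⟨-, hT, hS⟩ := Finset.mem_filter.1 hT
    obtain ⟨T', rfl⟩ := exists_extendTableau_eq h.le ((h.lastColumns_eq_iff hT).1 hS)
    exact ⟨T', Finset.mem_filter.2 ⟨Finset.mem_univ _, hT.of_extendTableau h.le⟩, rfl⟩
  · rw [prod_extendTableau x h.le, h.card_sdiff]

theorem tableauSum_bot (x : Fin l → A) : tableauSum x ⊥ = 1 := by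
  classical
  have hE : IsEmpty (⊥ : YoungDiagram).cells := inferInstanceAs (IsEmpty (∅ : Finset (ℕ × ℕ)))
  rw [tableauSum, Finset.filter_true_of_mem fun T _ => ⟨hE.elim, hE.elim⟩]
  simp

theorem tableauSum_of_isEmpty (x : Fin 0 → A) (hM : mu.rowLen 0 ≤ M) :
    tableauSum x mu =
      (jacobiTrudi (1 : A⟦X⟧) fun i : Fin M => (mu.colLen i : ℤ)).det := by
  by_cases hmu : (0, 0) ∈ mu
  · have hM0 : 0 < M := (YoungDiagram.mem_iff_lt_rowLen.1 hmu).trans_le hM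
    have hcol : 0 < mu.colLen 0 := YoungDiagram.mem_iff_lt_colLen.1 hmu
    rw [tableauSum, Matrix.det_eq_zero_of_row_eq_zero ⟨0, hM0⟩ fun j => ?_]
    · exact Finset.sum_eq_zero fun T _ => (T ⟨_, hmu⟩).elim0
    · rw [jacobiTrudi_apply, intCoeff_one, if_neg (by simp only; omega)]
  · obtain rfl : mu = ⊥ := SetLike.ext fun c => iff_of_false
      (fun hc => hmu (mu.up_left_mem (Nat.zero_le _) (Nat.zero_le _) hc))
      (YoungDiagram.notMem_bot c)
    have hcol : (fun i : Fin M => ((⊥ : YoungDiagram).colLen i : ℤ)) = 0 :=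
      funext fun i => Nat.cast_eq_zero.2 (by_contra fun h0 => YoungDiagram.notMem_bot _
        (YoungDiagram.mem_iff_lt_colLen.2 (Nat.pos_of_ne_zero h0)))
    rw [tableauSum_bot, hcol, det_jacobiTrudi_zero (by simp)]

theorem tableauSum_eq_det_jacobiTrudi (x : Fin l → A) (hM : mu.rowLen 0 ≤ M) :
    tableauSum x mu =
      (jacobiTrudi (∏ i, (1 + PowerSeries.C (x i) * PowerSeries.X)) fun i : Fin M =>
        (mu.colLen i : ℤ)).det := by
  classical
  induction l generalizing mu with
  | zero => simpa using tableauSum_of_isEmpty x hM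
  | succ l ih =>
    rw [Fin.prod_univ_castSucc, mul_comm, det_jacobiTrudi_one_add_C_mul_X_mul, tableauSum,
      ← Finset.sum_fiberwise _ (lastColumns M)]
    refine Finset.sum_congr rfl fun S _ => ?_
    rw [Finset.filter_filter]
    by_cases hS : ∃ nu, IsStripRemoval mu nu S
    · obtain ⟨nu, h⟩ := hS
      rw [h.sum_tableaux, h.removeBoxes_eq, ih _ h.rowLen_right_le]
    · have hanti : Antitone fun i : Fin M => (mu.colLen i : ℤ) :=
        fun i j hij => Nat.cast_le.2 (mu.colLen_anti i j hij)
      rw [det_jacobiTrudi_removeBoxes_eq_zero _ hanti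
        fun h => hS (exists_isStripRemoval hM h.1 h.2), mul_zero, Finset.filter_false_of_mem,
        Finset.sum_empty]
      rintro T - ⟨hT, rfl⟩
      exact hS (hT.exists_isStripRemoval hM)

end Tableaux

section SchurPolynomial

variable {N k : ℕ}

theorem rowLen_diagram (lam : BoxPartition N k) (i : Fin N) :
    (diagram lam).rowLen i = (lam.1 i : ℕ) := by
  refine eq_of_forall_lt_iff fun j => ?_
  have hk := part_le lam i
  rw [← YoungDiagram.mem_iff_lt_rowLen, ← YoungDiagram.mem_cells, diagram, Finset.mem_filter,
    Finset.mem_product, Finset.mem_range, Finset.mem_range, ← part_val]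
  simp only [i.2, true_and, and_iff_right_iff_imp]
  omega

theorem rowLen_transpose_diagram_le (lam : BoxPartition N k) :
    (diagram lam).transpose.rowLen 0 ≤ N := by
  by_contra! hN
  have hmem := YoungDiagram.mem_transpose.1 (YoungDiagram.mem_iff_lt_rowLen.2 hN)
  rw [← YoungDiagram.mem_cells, diagram] at hmem
  simp at hmem

theorem prod_one_add_C_mul_X_eq_elemPoly {A : Type*} [CommRing A] (x : Fin k → A) :
    ∏ i, (1 + Polynomial.C (x i) * Polynomial.X) =
      elemPoly fun i : Fin k =>
        ∑ t ∈ Finset.powersetCard ((i : ℕ) + 1) Finset.univ, ∏ j ∈ t, x j := by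
  set Q : A[X] := ∏ i, (1 + Polynomial.C (x i) * Polynomial.X) with hQ
  have hdeg : Q.natDegree ≤ k := by
    refine (Polynomial.natDegree_prod_le _ _).trans
      ((Finset.sum_le_card_nsmul _ _ 1 fun i _ => ?_).trans (by simp))
    compute_degree
  have hcoeff (r : ℕ) : Q.coeff r = ∑ t ∈ Finset.powersetCard r Finset.univ, ∏ j ∈ t, x j := by
    rw [hQ, Finset.prod_one_add, Polynomial.finsetSum_coeff, Finset.powersetCard_eq_filter,
      Finset.sum_filter]
    refine Finset.sum_congr rfl fun t _ => ?_
    rw [Finset.prod_mul_distrib, Finset.prod_const, ← map_prod, Polynomial.coeff_C_mul,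
      Polynomial.coeff_X_pow]
    simp only [mul_ite, mul_one, mul_zero, eq_comm]
  rw [← elemPoly_coeff_succ hdeg (by simp [hcoeff])]
  simp only [hcoeff]

theorem esymmAlgHom_schurE (lam : BoxPartition N k) :
    (MvPolynomial.esymmAlgHom (Fin k) ℂ k (schurE lam) : MvPolynomial (Fin k) ℂ) =
      schurPoly k (diagram lam).transpose := by
  let f : MvPolynomial (Fin k) ℂ →+* MvPolynomial (Fin k) ℂ :=
    ((MvPolynomial.symmetricSubalgebra (Fin k) ℂ).val.comp
      (MvPolynomial.esymmAlgHom (Fin k) ℂ k)).toRingHom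
  have hf : ⇑f ∘ MvPolynomial.X = fun i : Fin k => MvPolynomial.esymm (Fin k) ℂ (i + 1) := by
    funext i
    simp [f, MvPolynomial.esymmAlgHom]
  have hcol : (fun i : Fin N => ((lam.1 i : ℕ) : ℤ)) =
      fun i : Fin N => ((diagram lam).transpose.colLen i : ℤ) :=
    funext fun i => by rw [YoungDiagram.colLen_transpose, rowLen_diagram]
  change f (schurE lam) = tableauSum MvPolynomial.X _
  rw [tableauSum_eq_det_jacobiTrudi _ (rowLen_transpose_diagram_le lam), schurE,
    map_det_jacobiTrudi, map_elemPoly, hf, hcol]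
  congr 2
  refine (congrArg Polynomial.coeToPowerSeries.ringHom
    (prod_one_add_C_mul_X_eq_elemPoly MvPolynomial.X)).symm.trans ?_
  simp [map_prod]

end SchurPolynomial

end PhaseModel

end

theorem mainTheorem7 (N k : ℕ) :
    (∃ Φ : placticSchurAlgebra N k ≃ₐ[ℂ] (MvPolynomial (Fin k) ℂ ⧸ betheIdeal (N + 1) k),
      ∀ lam : BoxPartition N k, ∃ p : MvPolynomial (Fin k) ℂ,
        (MvPolynomial.esymmAlgHom (Fin k) ℂ k p : MvPolynomial (Fin k) ℂ) =
            schurPoly k (diagram lam).transpose ∧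
          Φ (placticSchurGen lam) = Ideal.Quotient.mk (betheIdeal (N + 1) k) p) ∧
    (∀ lam mu : BoxPartition N k,
      placticSchurLevel lam * placticSchurLevel mu =
        ∑ nu : BoxPartition N k, fusionCoeff lam mu nu • placticSchurLevel nu) ∧
    (∀ lam mu : BoxPartition N k,
      placticSchurLevel lam (weightVec mu) =
        ∑ nu : BoxPartition N k, fusionCoeff lam mu nu • weightVec nu) :=
  ⟨⟨placticSchurAlgebraEquiv N k, fun lam =>
      ⟨schurE lam, esymmAlgHom_schurE lam, placticSchurAlgebraEquiv_placticSchurGen lam⟩⟩,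
    placticSchurLevel_mul, placticSchurLevel_weightVec⟩
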